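/- **Notation.** For a Borel probability measure $\mu$ on $\mathbf R$ and $\alpha>0$, let $\omega_1,\omega_2,\dots$ be independent with law $\mu$, let $E_\alpha(\omega)=\bigcap_{k\ge1}\bigcup_{n\ge k}\overline B(\omega_n,n^{-\alpha})$, and let $f_\mu(\alpha)$ be the almost sure value of $\dim_H E_\alpha(\omega)$. The lower and upper local dimensions of $\mu$ at $x$ are $$\underline d_\mu(x)=\sup\{s\in\mathbf R:\exists c\ \forall r>0,\ \mu(B(x,r))\le c r^s\},\qquad \overline d_\mu(x)=\inf\{s\in\mathbf R:\exists c>0\ \forall r\in(0,1],\ \mu(B(x,r))\ge c r^s\}$$ (values in $[-\infty,\infty]$, $\inf\emptyset=\infty$). For $s\in\mathbf R$ let $F_\mu(s)=\dim_H\{x\in\operatorname{supp}\mu:\underline d_\mu(x)\le s\}$ and $H_\mu(s)=\dim_P\{x:\underline d_\mu(x)\le s\}$, where $\dim_H$ and $\dim_P$ are Hausdorff and packing dimension ($\dim\emptyset=0$). Let $\bar F_\mu(s)=\inf\{h(s):h\ge F_\mu,\ h:\mathbf R\to\mathbf R \text{ increasing and 1-Lipschitz}\}$. **The measure.** Let $\lambda\in(0,1/3)$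 and $\beta>1$, and let $\nu$ be the Bernoulli convolution with parameter $\lambda$, that is, the law of $\sum_{n\ge0}\pm\lambda^n$ with independent fair signs. Let $C$ be the ternary Cantor set and let $C_k$ be the $k$-th step of its standard construction, a union of $2^k$ closed intervals of length $3^{-k}$. For each $k\ge0$ and each interval $I$ of $C_k$ choose a nonconstant affine map $\varphi_{k,I}$ that maps $\operatorname{supp}\nu$ into the closed middle ninth of $I$ (any choice is allowed), let $\mu_k$ be the sum of the $2^k$ images of $\nu$ under these maps, and let $$\mu=(1-2^{1-\beta})\sum_{k=0}^\infty 2^{-\beta k}\mu_k .$$ Put $s_0=\dfrac{\log 2}{-\log\lambda}$, $s_1=\dfrac{\beta\log2}{\log3}$, $d_1=\dfrac{\log 2}{\log 3}$. **Claim.** 1. $\mu$ is a probability measure and $\operatorname{supp}\mu=C\cup\bigcup_{k\ge0}\operatorname{supp}\mu_k$. 2. $\underline d_\mu(x)=\overline d_\mu(x)$ for every $x\in\mathbf R$; the common value is $s_0$ if $x\in\bigcup_{k\ge0}\operatorname{supp}\mu_k$, it is $s_1$ if $x\in C$, and it is $\infty$ if $x\notin\operatorname{supp}\mu$. 3. For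 every $s\in\mathbf R$, $F_\mu(s)=H_\mu(s)$, and $F_\mu(s)=0$ if $s<s_0$, $F_\mu(s)=s_0$ if $s_0\le s<s_1$, $F_\mu(s)=d_1$ if $s\ge s_1$. 4. For every $s\ge0$, $\bar F_\mu(s)=\max\bigl(\min(s,s_0),\ \min(s,s_1)-(s_1-d_1)\bigr)$, and $\bar F_\mu$ is not concave on $(0,\infty)$. 5. For every $\alpha>0$, $\dim_H E_\alpha(\omega)$ is almost surely constant, and its almost sure value is $f_\mu(\alpha)=\bar F_\mu(1/\alpha)$. In particular, if $1/\alpha\le s_1$ then $$f_\mu(\alpha)\ \ge\ \frac1\alpha-(s_1-d_1)=\frac1\alpha-(\beta-1)\frac{\log2}{\log3}.$$ -/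

import Mathlib

open Set Filter Topology MeasureTheory
open scoped NNReal ENNReal

noncomputable section

/-- The random limsup set `E_α(ω) = ⋂_k ⋃_{n ≥ k} B[ω_n, n^{-α}]`, `n = 1, 2, …`
(the `n`-th centre is stored in coordinate `n - 1`). -/
def limsupBalls {X : Type*} [PseudoMetricSpace X] (α : ℝ) (ω : ℕ → X) : Set X :=
  ⋂ k : ℕ, ⋃ n : ℕ, ⋃ _ : k ≤ n, Metric.closedBall (ω n) (((n : ℝ) + 1) ^ (-α))

/-- `f_μ(α)`: the almost sure value of `dim_H E_α` when the centres are independent with law `μ`.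
It is defined here as the essential supremum of `dim_H E_α`, which is the almost sure value
whenever `dim_H E_α` is almost surely constant. -/
def coveringDim {X : Type*} [MetricSpace X] [MeasurableSpace X]
    (μ : Measure X) (α : ℝ) : ℝ≥0∞ :=
  essSup (fun ω : ℕ → X => dimH (limsupBalls α ω)) (Measure.infinitePi fun _ : ℕ => μ)

/-- The lower local dimension of `μ` at `x`. -/
def lowerLocalDim {X : Type*} [PseudoMetricSpace X] [MeasurableSpace X]
    (μ : Measure X) (x : X) : EReal :=
  sSup ((fun s : ℝ => (s : EReal)) ''
    {s : ℝ | ∃ c : ℝ, ∀ r : ℝ, 0 < r → μ (Metric.ball x r) ≤ ENNReal.ofReal (c * r ^ s)})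

/-- The upper local dimension of `μ` at `x`. The lower bound `c r ^ s`, with `c > 0`, is asked for
small radii only. It is `⊤` outside the support of `μ`. -/
def upperLocalDim {X : Type*} [PseudoMetricSpace X] [MeasurableSpace X]
    (μ : Measure X) (x : X) : EReal :=
  sInf ((fun s : ℝ => (s : EReal)) ''
    {s : ℝ | ∃ c : ℝ, 0 < c ∧ ∀ r : ℝ, 0 < r → r ≤ 1 →
      ENNReal.ofReal (c * r ^ s) ≤ μ (Metric.ball x r)})

/-- The Hausdorff spectrum `F_μ` of the lower local dimension. -/
def hausdorffSpectrum {X : Type*} [MetricSpace X] [MeasurableSpace X]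
    (μ : Measure X) (s : ℝ) : ℝ≥0∞ :=
  dimH {x : X | x ∈ μ.support ∧ lowerLocalDim μ x ≤ (s : EReal)}

/-- The upper box (Minkowski) dimension `limsup_{r → 0} log N_r(A) / (- log r)`, where `N_r(A)` is
the least number of closed balls of radius `r` that cover `A`. -/
def upperBoxDim {X : Type*} [PseudoMetricSpace X] (A : Set X) : EReal :=
  limsup (fun r : ℝ≥0 =>
    ENNReal.log (Metric.externalCoveringNumber r A : ℝ≥0∞) / ((-Real.log (r : ℝ) : ℝ) : EReal))
    (𝓝[>] (0 : ℝ≥0))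

/-- The packing dimension: the infimum of those `t` for which the set has a countable cover by
sets of upper box dimension at most `t`. -/
def packingDim {X : Type*} [PseudoMetricSpace X] (S : Set X) : ℝ≥0∞ :=
  sInf {t : ℝ≥0∞ | ∃ A : ℕ → Set X, (∀ i, upperBoxDim (A i) ≤ (t : EReal)) ∧ S ⊆ ⋃ i, A i}

/-- The packing spectrum `H_μ` of the lower local dimension. -/
def packingSpectrum {X : Type*} [PseudoMetricSpace X] [MeasurableSpace X]
    (μ : Measure X) (s : ℝ) : ℝ≥0∞ :=
  packingDim {x : X | lowerLocalDim μ x ≤ (s : EReal)}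

/-- The increasing 1-Lipschitz hull of `g`: the pointwise infimum of all increasing 1-Lipschitz
functions that lie above `g`. -/
def increasingLipschitzHull (g : ℝ → ℝ) (x : ℝ) : ℝ :=
  sInf {y : ℝ | ∃ h : ℝ → ℝ, Monotone h ∧ LipschitzWith 1 h ∧ (∀ z, g z ≤ h z) ∧ y = h x}

/-- `F̄_μ`, the increasing 1-Lipschitz hull of the Hausdorff spectrum. -/
def hausdorffSpectrumHull {X : Type*} [MetricSpace X] [MeasurableSpace X]
    (μ : Measure X) (s : ℝ) : ℝ :=
  increasingLipschitzHull (fun z => (hausdorffSpectrum μ z).toReal) s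

/-- The Bernoulli convolution with parameter `lam`: the law of `∑_{n ≥ 0} ± lam ^ n`, where the
signs are independent and fair. -/
def bernoulliConvolution (lam : ℝ) : Measure ℝ :=
  (Measure.infinitePi fun _ : ℕ => (PMF.uniformOfFintype Bool).toMeasure).map
    (fun σ : ℕ → Bool => ∑' n : ℕ, (if σ n then (1 : ℝ) else -1) * lam ^ n)

/-- The left end point of the interval of `C_k` with address `w`. The `2 ^ k` intervals of the
`k`-th step of the construction of the ternary Cantor set are
`[cantorLeft w, cantorLeft w + 3^{-k}]`, for `w : Fin k → Bool`. -/
def cantorLeft {k : ℕ} (w : Fin k → Bool) : ℝ :=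
  ∑ i : Fin k, if w i then 2 * (1 / 3 : ℝ) ^ ((i : ℕ) + 1) else 0

/-- The closed middle ninth of the interval of `C_k` with address `w`. -/
def middleNinth {k : ℕ} (w : Fin k → Bool) : Set ℝ :=
  Icc (cantorLeft w + 4 / 9 * (1 / 3 : ℝ) ^ k) (cantorLeft w + 5 / 9 * (1 / 3 : ℝ) ^ k)

/-- `μ_k`: the sum of the `2 ^ k` images of the Bernoulli convolution under the affine maps
`x ↦ a k w * x + b k w`. -/
def levelMeasure (lam : ℝ) (a b : (k : ℕ) → (Fin k → Bool) → ℝ) (k : ℕ) : Measure ℝ :=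
  ∑ w : Fin k → Bool, (bernoulliConvolution lam).map (fun x => a k w * x + b k w)

/-- `μ = (1 - 2^{1-β}) ∑_k 2^{-βk} μ_k`. -/
def gapMeasure (lam β : ℝ) (a b : (k : ℕ) → (Fin k → Bool) → ℝ) : Measure ℝ :=
  ENNReal.ofReal (1 - 2 ^ (1 - β)) •
    Measure.sum fun k : ℕ => ENNReal.ofReal (2 ^ (-β * k)) • levelMeasure lam a b k

end

/-!
The supports of the pieces of `μ` and the Cantor set `C` are Cantor sets coded by the infinite
binary tree, with contraction ratios `λ` and `1 / 3`, and the mass distribution principle for the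
fair coin measure gives their dimensions. A point outside `C` sees finitely many levels only, so
that on `⋃ supp μ_k` the measure looks like the Bernoulli convolution. Near `C`, a neighbourhood
of radius about `3 ^ (-l)` meets middle ninths of levels at least `l` only, whose total mass is
`2 ^ ((1 - β) l)`; a ball of this radius at a point of `C` sees a fraction `2 ^ (-l)` of them,
which gives the local dimension `s₁`.

For the random limsup set, the balls whose centres lie near `C` have finite expected
`t`-dimensional mass for `t > 1 / α - (s₁ - d₁)`, which bounds the dimension of the part in `C`;
the bound by `1 / α` holds for any measure. For the lower bounds, by Borel–Cantelli almost surely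
every cylinder of depth `k` contains, at a depth proportional to `k`, a cylinder whose points are
covered by a ball of large index. Forcing the digits of a random point in a sparse sequence of
such blocks makes it belong to the limsup set, at an arbitrarily small loss of dimension beyond
the proportionality factor. This applies to the copy of `supp ν` of level `0` and to `C`, a point
of which is approximated at all scales by middle ninths.
-/

/-! ### Binary codings -/

/-- The law of a sequence of independent fair coin tosses. -/
noncomputable abbrev coinMeasure : Measure (ℕ → Bool) :=
  Measure.infinitePi fun _ : ℕ => (PMF.uniformOfFintype Bool).toMeasure

theorem measurableSet_cylinder (u : ℕ → Bool) (l : ℕ) : MeasurableSet (PiNat.cylinder u l) :=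
  (PiNat.isOpen_cylinder _ u l).measurableSet

theorem coinMeasure_setOf_eq_on (T : Finset ℕ) (v : ℕ → Bool) :
    coinMeasure {u | ∀ i ∈ T, u i = v i} = (2⁻¹ : ℝ≥0∞) ^ T.card := by
  have hpi : {u : ℕ → Bool | ∀ i ∈ T, u i = v i} = (T : Set ℕ).pi fun i => {v i} := by
    ext u
    simp [Set.mem_pi]
  have hcoin (b : Bool) : (PMF.uniformOfFintype Bool).toMeasure {b} = 2⁻¹ := by
    rw [PMF.toMeasure_apply_singleton _ _ (measurableSet_singleton b)]
    simp
  rw [hpi, Measure.infinitePi_pi _ fun i _ => measurableSet_singleton _]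
  simp [hcoin]

theorem coinMeasure_cylinder (u : ℕ → Bool) (l : ℕ) :
    coinMeasure (PiNat.cylinder u l) = (2⁻¹ : ℝ≥0∞) ^ l := by
  simpa [PiNat.cylinder] using coinMeasure_setOf_eq_on (Finset.range l) u

/-- The similarity dimension `log 2 / log (1 / ρ)` of a set made of two copies of itself scaled
by `ρ`. -/
noncomputable def treeDim (ρ : ℝ) : ℝ := Real.log 2 / -Real.log ρ

theorem treeDim_pos {ρ : ℝ} (h0 : 0 < ρ) (h1 : ρ < 1) : 0 < treeDim ρ :=
  div_pos (Real.log_pos one_lt_two) (neg_pos.2 (Real.log_neg h0 h1))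

theorem treeDim_lt_treeDim {ρ σ : ℝ} (h0 : 0 < ρ) (hρσ : ρ < σ) (h1 : σ < 1) :
    treeDim ρ < treeDim σ :=
  div_lt_div_of_pos_left (Real.log_pos one_lt_two) (neg_pos.2 (Real.log_neg (h0.trans hρσ) h1))
    (neg_lt_neg (Real.log_lt_log h0 hρσ))

theorem treeDim_le_treeDim {ρ σ : ℝ} (h0 : 0 < ρ) (hρσ : ρ ≤ σ) (h1 : σ < 1) :
    treeDim ρ ≤ treeDim σ :=
  hρσ.eq_or_lt.elim (fun h => (congrArg treeDim h).le) fun h => (treeDim_lt_treeDim h0 h h1).le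

theorem rpow_treeDim {ρ : ℝ} (h0 : 0 < ρ) (h1 : ρ < 1) : ρ ^ treeDim ρ = 1 / 2 := by
  have hlog : Real.log ρ ≠ 0 := (Real.log_neg h0 h1).ne
  rw [treeDim, Real.rpow_def_of_pos h0, div_neg, mul_neg, mul_div_cancel₀ _ hlog, Real.exp_neg,
    Real.exp_log two_pos, one_div]

theorem pow_rpow_treeDim {ρ : ℝ} (h0 : 0 < ρ) (h1 : ρ < 1) (l : ℕ) :
    (ρ ^ l) ^ treeDim ρ = (1 / 2) ^ l := by
  rw [← Real.rpow_pow_comm h0.le, rpow_treeDim h0 h1]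

theorem coinMeasure_cylinder_eq_ofReal {ρ : ℝ} (h0 : 0 < ρ) (h1 : ρ < 1) (u : ℕ → Bool) (l : ℕ) :
    coinMeasure (PiNat.cylinder u l) = ENNReal.ofReal ((ρ ^ l) ^ treeDim ρ) := by
  rw [coinMeasure_cylinder, pow_rpow_treeDim h0 h1, ENNReal.ofReal_pow (by norm_num), one_div,
    ENNReal.ofReal_inv_of_pos two_pos, ENNReal.ofReal_ofNat]

/-- The sequence that starts with `w` and continues with `false`. -/
def extendFalse {l : ℕ} (w : Fin l → Bool) : ℕ → Bool :=
  fun i => if h : i < l then w ⟨i, h⟩ else false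

theorem extendFalse_of_lt {l : ℕ} (w : Fin l → Bool) {i : ℕ} (hi : i < l) :
    extendFalse w i = w ⟨i, hi⟩ :=
  dif_pos hi

theorem extendFalse_coe {l : ℕ} (w : Fin l → Bool) (i : Fin l) : extendFalse w i = w i :=
  extendFalse_of_lt w i.isLt

theorem extendFalse_mem_cylinder (u : ℕ → Bool) (l : ℕ) :
    extendFalse (fun i : Fin l => u i) ∈ PiNat.cylinder u l :=
  fun _ hi => extendFalse_of_lt _ hi

/-- A parametrization `F` of a subset of a metric space by the infinite binary tree, for which a
cylinder of length `l` has diameter of order at most `ρ ^ l`, and two distinct cylinders of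
length `l` have distance of order at least `ρ ^ l`. -/
structure IsBinaryCoding {X : Type*} [MetricSpace X] (ρ : ℝ) (F : (ℕ → Bool) → X) : Prop where
  pos : 0 < ρ
  lt_one : ρ < 1
  exists_dist_le : ∃ A : ℝ, 0 < A ∧
    ∀ u l, ∀ v ∈ PiNat.cylinder u l, dist (F v) (F u) ≤ A * ρ ^ l
  exists_mem_cylinder : ∃ B : ℝ, 0 < B ∧
    ∀ u v l, dist (F v) (F u) < B * ρ ^ l → v ∈ PiNat.cylinder u l

namespace IsBinaryCoding

variable {X : Type*} [MetricSpace X] {ρ : ℝ} {F : (ℕ → Bool) → X}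

theorem exists_cylinder_subset_preimage_ball (hF : IsBinaryCoding ρ F) (u : ℕ → Bool) {r : ℝ}
    (hr : 0 < r) : ∃ l, PiNat.cylinder u l ⊆ F ⁻¹' Metric.ball (F u) r := by
  obtain ⟨A, hA, hAF⟩ := hF.exists_dist_le
  obtain ⟨l, hl⟩ := exists_pow_lt_of_lt_one (div_pos hr hA) hF.lt_one
  exact ⟨l, fun v hv => (hAF u l v hv).trans_lt ((lt_div_iff₀' hA).1 hl)⟩

protected theorem continuous (hF : IsBinaryCoding ρ F) : Continuous F := by
  refine continuous_iff_continuousAt.2 fun u => Metric.nhds_basis_ball.tendsto_right_iff.2 ?_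
  intro r hr
  obtain ⟨l, hl⟩ := hF.exists_cylinder_subset_preimage_ball u hr
  exact mem_of_superset ((PiNat.isOpen_cylinder _ u l).mem_nhds (PiNat.self_mem_cylinder u l)) hl

protected theorem measurable [MeasurableSpace X] [BorelSpace X] (hF : IsBinaryCoding ρ F) :
    Measurable F :=
  hF.continuous.measurable

protected theorem injective (hF : IsBinaryCoding ρ F) : Function.Injective F := by
  obtain ⟨B, hB, hBF⟩ := hF.exists_mem_cylinder
  intro u v huv
  ext i
  refine hBF v u (i + 1) ?_ i i.lt_succ_self
  rw [huv, dist_self]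
  exact mul_pos hB (pow_pos hF.pos _)

theorem exists_cylinder_of_dist_le (hF : IsBinaryCoding ρ F) : ∃ K : ℝ≥0, ∀ δ : ℝ, 0 < δ →
    ∃ l, ρ ^ l ≤ K * δ ∧ ∀ u v, dist (F v) (F u) ≤ δ → v ∈ PiNat.cylinder u l := by
  obtain ⟨B, hB, hBF⟩ := hF.exists_mem_cylinder
  have h0 := hF.pos
  refine ⟨(2 / (B * ρ)).toNNReal, fun δ hδ => ?_⟩
  rw [Real.coe_toNNReal _ (by positivity), show 2 / (B * ρ) * δ = 2 * δ / B / ρ by field_simp]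
  rcases le_or_gt (2 * δ / B) 1 with hle | hgt
  · obtain ⟨l, hl, hl'⟩ := exists_nat_pow_near_of_lt_one (by positivity) hle h0 hF.lt_one
    refine ⟨l, (le_div_iff₀ h0).2 (pow_succ ρ l ▸ hl.le), fun u v huv => hBF u v l ?_⟩
    rw [div_le_iff₀ hB] at hl'
    linarith
  · refine ⟨0, ?_, fun u v _ => PiNat.cylinder_zero u ▸ mem_univ v⟩
    rw [pow_zero, one_le_div h0]
    exact hF.lt_one.le.trans hgt.le

variable [MeasurableSpace X] [BorelSpace X]

theorem map_apply_le_of_ediam_le (hF : IsBinaryCoding ρ F) (κ : Measure (ℕ → Bool)) {t : ℝ}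
    (ht : 0 < t) {C : ℝ≥0}
    (hκ : ∀ u l, κ (PiNat.cylinder u l) ≤ C * ENNReal.ofReal ((ρ ^ l) ^ t)) :
    ∃ C' : ℝ≥0, ∀ (S : Set X) (δ : ℝ), 0 < δ → Metric.ediam S ≤ ENNReal.ofReal δ →
      κ.map F S ≤ C' * ENNReal.ofReal (δ ^ t) := by
  obtain ⟨K, hK⟩ := hF.exists_cylinder_of_dist_le
  refine ⟨C * K ^ t, fun S δ hδ hS => ?_⟩
  refine (measure_mono subset_closure).trans ?_
  rw [Measure.map_apply hF.measurable isClosed_closure.measurableSet]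
  rcases (F ⁻¹' closure S).eq_empty_or_nonempty with he | ⟨u, hu⟩
  · simp only [he, measure_empty, zero_le]
  obtain ⟨l, hl, hcyl⟩ := hK δ hδ
  have hsub : F ⁻¹' closure S ⊆ PiNat.cylinder u l := fun v hv => by
    refine hcyl u v ((ENNReal.ofReal_le_ofReal_iff hδ.le).1 ?_)
    rw [← edist_dist]
    exact (Metric.edist_le_ediam_of_mem (mem_preimage.1 hv) (mem_preimage.1 hu)).trans
      (Metric.ediam_closure S ▸ hS)
  calc κ (F ⁻¹' closure S) ≤ C * ENNReal.ofReal ((ρ ^ l) ^ t) := (measure_mono hsub).trans (hκ u l)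
    _ ≤ C * ENNReal.ofReal ((K * δ) ^ t) := by
      gcongr
      exact pow_nonneg hF.pos.le l
    _ = (C * K ^ t : ℝ≥0) * ENNReal.ofReal (δ ^ t) := by
      rw [Real.mul_rpow K.coe_nonneg hδ.le, ENNReal.ofReal_mul (by positivity), ENNReal.coe_mul,
        ← mul_assoc, ← NNReal.coe_rpow, ENNReal.ofReal_coe_nnreal]

theorem map_apply_le (hF : IsBinaryCoding ρ F) (κ : Measure (ℕ → Bool)) {t : ℝ}
    (ht : 0 < t) {C : ℝ≥0}
    (hκ : ∀ u l, κ (PiNat.cylinder u l) ≤ C * ENNReal.ofReal ((ρ ^ l) ^ t)) :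
    ∃ C' : ℝ≥0, ∀ S : Set X, Metric.ediam S ≠ ⊤ → κ.map F S ≤ C' * Metric.ediam S ^ t := by
  obtain ⟨C', hC'⟩ := hF.map_apply_le_of_ediam_le κ ht hκ
  refine ⟨C', fun S hS => ?_⟩
  have hlim : Tendsto (fun δ : ℝ => C' * ENNReal.ofReal δ ^ t) (𝓝[>] (Metric.ediam S).toReal)
      (𝓝 (C' * Metric.ediam S ^ t)) := by
    have hcont : Continuous fun δ : ℝ => ENNReal.ofReal δ ^ t :=
      ENNReal.continuous_rpow_const.comp ENNReal.continuous_ofReal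
    have h := ENNReal.Tendsto.const_mul (a := (C' : ℝ≥0∞))
      (hcont.tendsto (Metric.ediam S).toReal) (Or.inr ENNReal.coe_ne_top)
    rw [ENNReal.ofReal_toReal hS] at h
    exact h.mono_left nhdsWithin_le_nhds
  refine ge_of_tendsto hlim ?_
  filter_upwards [self_mem_nhdsWithin] with δ hδ
  have hδ0 : 0 < δ := ENNReal.toReal_nonneg.trans_lt hδ
  rw [ENNReal.ofReal_rpow_of_pos hδ0]
  exact hC' S δ hδ0 ((ENNReal.le_ofReal_iff_toReal_le hS hδ0.le).2 (le_of_lt hδ))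

theorem ofReal_le_dimH (hF : IsBinaryCoding ρ F) (κ : Measure (ℕ → Bool)) [NeZero κ] {t : ℝ}
    (ht : 0 < t) {C : ℝ≥0}
    (hκ : ∀ u l, κ (PiNat.cylinder u l) ≤ C * ENNReal.ofReal ((ρ ^ l) ^ t))
    {E : Set X} (hE : ∀ᵐ u ∂κ, F u ∈ E) : ENNReal.ofReal t ≤ dimH E := by
  obtain ⟨C', hC'⟩ := hF.map_apply_le κ ht hκ
  have hle : (C' : ℝ≥0∞)⁻¹ • κ.map F ≤ Measure.hausdorffMeasure t := by
    refine Measure.le_hausdorffMeasure t _ 1 one_pos fun S hS => ?_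
    rw [Measure.smul_apply, smul_eq_mul, mul_comm, ← div_eq_mul_inv]
    exact ENNReal.div_le_of_le_mul' (hC' S (hS.trans_lt ENNReal.one_lt_top).ne)
  have hpos : κ.map F E ≠ 0 := by
    refine ((Measure.measure_univ_pos.2 (NeZero.ne κ)).trans_le ?_).ne'
    rw [← measure_congr (eventuallyEq_univ.2 hE)]
    exact Measure.le_map_apply hF.measurable.aemeasurable E
  refine le_dimH_of_hausdorffMeasure_ne_zero (d := t.toNNReal) ?_
  rw [Real.coe_toNNReal _ ht.le]
  refine (lt_of_lt_of_le ?_ (hle E)).ne'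
  rw [Measure.smul_apply, smul_eq_mul]
  exact ENNReal.mul_pos (ENNReal.inv_ne_zero.2 ENNReal.coe_ne_top) hpos

theorem coinMeasure_map_ball_le (hF : IsBinaryCoding ρ F) : ∃ C : ℝ≥0, ∀ (x : X) (r : ℝ), 0 < r →
    coinMeasure.map F (Metric.ball x r) ≤ C * ENNReal.ofReal (r ^ treeDim ρ) := by
  obtain ⟨C, hC⟩ := hF.map_apply_le_of_ediam_le coinMeasure (treeDim_pos hF.pos hF.lt_one)
    (C := 1) fun u l => by
      rw [coinMeasure_cylinder_eq_ofReal hF.pos hF.lt_one, ENNReal.coe_one, one_mul]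
  refine ⟨C * 2 ^ treeDim ρ, fun x r hr => ?_⟩
  refine (hC _ (2 * r) (by positivity) ?_).trans_eq ?_
  · rw [← Metric.eball_ofReal, ENNReal.ofReal_mul zero_le_two, ENNReal.ofReal_ofNat]
    exact Metric.ediam_eball_le
  · rw [Real.mul_rpow zero_le_two hr.le, ENNReal.ofReal_mul (by positivity), ENNReal.coe_mul,
      ← mul_assoc, ← ENNReal.ofReal_coe_nnreal (p := 2 ^ treeDim ρ)]
    simp

theorem ofReal_treeDim_le_dimH_range (hF : IsBinaryCoding ρ F) :
    ENNReal.ofReal (treeDim ρ) ≤ dimH (range F) :=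
  hF.ofReal_le_dimH coinMeasure (treeDim_pos hF.pos hF.lt_one) (C := 1)
    (fun u l => by rw [coinMeasure_cylinder_eq_ofReal hF.pos hF.lt_one, ENNReal.coe_one, one_mul])
    (ae_of_all _ mem_range_self)

theorem le_coinMeasure_map_ball (hF : IsBinaryCoding ρ F) : ∃ c : ℝ, 0 < c ∧
    ∀ u, ∀ r : ℝ, 0 < r → r ≤ 1 →
      ENNReal.ofReal (c * r ^ treeDim ρ) ≤ coinMeasure.map F (Metric.ball (F u) r) := by
  obtain ⟨A, hA, hAF⟩ := hF.exists_dist_le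
  have h0 := hF.pos
  refine ⟨(ρ / (A + 1)) ^ treeDim ρ, by positivity, fun u r hr hr1 => ?_⟩
  obtain ⟨l, hl, hl'⟩ := exists_nat_pow_near_of_lt_one (x := r / (A + 1)) (by positivity)
    (by rw [div_le_one₀] <;> linarith) h0 hF.lt_one
  rw [Measure.map_apply hF.measurable measurableSet_ball]
  calc ENNReal.ofReal ((ρ / (A + 1)) ^ treeDim ρ * r ^ treeDim ρ)
      ≤ ENNReal.ofReal ((ρ ^ (l + 1)) ^ treeDim ρ) := by
        rw [← Real.mul_rpow (by positivity) hr.le, div_mul_eq_mul_div, mul_div_assoc, pow_succ']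
        have := (treeDim_pos h0 hF.lt_one).le
        gcongr
    _ = coinMeasure (PiNat.cylinder u (l + 1)) :=
        (coinMeasure_cylinder_eq_ofReal h0 hF.lt_one u _).symm
    _ ≤ coinMeasure (F ⁻¹' Metric.ball (F u) r) := by
        refine measure_mono fun v hv => (hAF u _ v hv).trans_lt ?_
        rw [lt_div_iff₀ (by linarith)] at hl
        nlinarith [pow_pos h0 (l + 1)]

theorem support_coinMeasure_map (hF : IsBinaryCoding ρ F) :
    (coinMeasure.map F).support = range F := by
  have hclosed : IsClosed (range F) := (isCompact_range hF.continuous).isClosed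
  refine Subset.antisymm (Measure.support_subset_of_isClosed hclosed ?_) ?_
  · exact (mem_ae_map_iff hF.measurable.aemeasurable hclosed.measurableSet).2
      (univ_mem' mem_range_self)
  · rintro _ ⟨u, rfl⟩
    refine Metric.nhds_basis_ball.mem_measureSupport.2 fun r hr => ?_
    obtain ⟨l, hl⟩ := hF.exists_cylinder_subset_preimage_ball u hr
    rw [Measure.map_apply hF.measurable measurableSet_ball]
    refine lt_of_lt_of_le ?_ (measure_mono hl)
    rw [coinMeasure_cylinder]
    exact ENNReal.pow_pos (by simp) l

end IsBinaryCoding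

/-! ### Sign series and the ternary Cantor set -/

/-- The sum `∑ ± ρ ^ n` whose signs are given by `u`. -/
noncomputable def signSeries (ρ : ℝ) (u : ℕ → Bool) : ℝ :=
  ∑' n : ℕ, (if u n then (1 : ℝ) else -1) * ρ ^ n

section SignSeries

variable {ρ : ℝ}

theorem norm_sign_mul_pow (h0 : 0 < ρ) (u : ℕ → Bool) (n : ℕ) :
    ‖(if u n then (1 : ℝ) else -1) * ρ ^ n‖ = ρ ^ n := by
  rw [norm_mul, Real.norm_eq_abs, Real.norm_eq_abs, abs_of_pos (pow_pos h0 n)]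
  split_ifs <;> simp

theorem summable_signSeries (h0 : 0 < ρ) (h1 : ρ < 1) (u : ℕ → Bool) :
    Summable fun n : ℕ => (if u n then (1 : ℝ) else -1) * ρ ^ n :=
  .of_norm_bounded (summable_geometric_of_lt_one h0.le h1) fun n => (norm_sign_mul_pow h0 u n).le

theorem abs_signSeries_le (h0 : 0 < ρ) (h1 : ρ < 1) (u : ℕ → Bool) :
    |signSeries ρ u| ≤ (1 - ρ)⁻¹ :=
  tsum_of_norm_bounded (hasSum_geometric_of_lt_one h0.le h1) fun n => (norm_sign_mul_pow h0 u n).le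

theorem signSeries_eq_sum_add (h0 : 0 < ρ) (h1 : ρ < 1) (u : ℕ → Bool) (l : ℕ) :
    signSeries ρ u = ∑ i ∈ Finset.range l, (if u i then (1 : ℝ) else -1) * ρ ^ i
      + ρ ^ l * signSeries ρ (fun i => u (i + l)) := by
  rw [signSeries, ← (summable_signSeries h0 h1 u).sum_add_tsum_nat_add l, signSeries,
    ← tsum_mul_left]
  congr 2
  ext i
  ring

theorem abs_signSeries_sub_of_mem_cylinder (h0 : 0 < ρ) (h1 : ρ < 1) {u v : ℕ → Bool} {l : ℕ}
    (h : v ∈ PiNat.cylinder u l) : |signSeries ρ v - signSeries ρ u| =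
      ρ ^ l * |signSeries ρ (fun i => v (i + l)) - signSeries ρ (fun i => u (i + l))| := by
  rw [signSeries_eq_sum_add h0 h1 u l, signSeries_eq_sum_add h0 h1 v l,
    Finset.sum_congr rfl fun i hi => by rw [h i (Finset.mem_range.1 hi)], add_sub_add_left_eq_sub,
    ← mul_sub, abs_mul, abs_of_pos (pow_pos h0 l)]

theorem abs_signSeries_sub_le (h0 : 0 < ρ) (h1 : ρ < 1) {u v : ℕ → Bool} {l : ℕ}
    (h : v ∈ PiNat.cylinder u l) : |signSeries ρ v - signSeries ρ u| ≤ 2 * (1 - ρ)⁻¹ * ρ ^ l := by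
  rw [abs_signSeries_sub_of_mem_cylinder h0 h1 h, mul_comm]
  have := pow_pos h0 l
  gcongr
  refine (abs_sub _ _).trans ?_
  linarith [abs_signSeries_le h0 h1 fun i => u (i + l), abs_signSeries_le h0 h1 fun i => v (i + l)]

theorem le_abs_signSeries_sub_of_apply_zero_ne (h0 : 0 < ρ) (h1 : ρ < 1) {u v : ℕ → Bool}
    (h : v 0 ≠ u 0) : 2 - 2 * ρ * (1 - ρ)⁻¹ ≤ |signSeries ρ v - signSeries ρ u| := by
  have hu := abs_le.1 (abs_signSeries_le h0 h1 fun i => u (i + 1))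
  have hv := abs_le.1 (abs_signSeries_le h0 h1 fun i => v (i + 1))
  rw [signSeries_eq_sum_add h0 h1 u 1, signSeries_eq_sum_add h0 h1 v 1, le_abs]
  simp only [Finset.sum_range_one, pow_zero, pow_one, mul_one]
  cases hv0 : v 0 <;> cases hu0 : u 0
  · exact absurd (hv0.trans hu0.symm) h
  · right
    norm_num
    nlinarith
  · left
    norm_num
    nlinarith
  · exact absurd (hv0.trans hu0.symm) h

theorem two_sub_mul_inv_pos (h1 : ρ < 1 / 2) : 0 < 2 - 2 * ρ * (1 - ρ)⁻¹ := by
  rw [sub_pos, ← div_eq_mul_inv, div_lt_iff₀ (by linarith)]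
  linarith

theorem le_abs_signSeries_sub (h0 : 0 < ρ) (h1 : ρ < 1 / 2) {u v : ℕ → Bool} {l : ℕ}
    (h : v ∉ PiNat.cylinder u (l + 1)) :
    (2 - 2 * ρ * (1 - ρ)⁻¹) * ρ ^ l ≤ |signSeries ρ v - signSeries ρ u| := by
  have h1' : ρ < 1 := by linarith
  have hne : v ≠ u := fun he => h (he ▸ PiNat.self_mem_cylinder u _)
  have hm : PiNat.firstDiff v u ≤ l := by
    rw [PiNat.mem_cylinder_comm, PiNat.mem_cylinder_iff_le_firstDiff hne.symm,
      PiNat.firstDiff_comm] at h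
    lia
  rw [abs_signSeries_sub_of_mem_cylinder h0 h1' (PiNat.mem_cylinder_firstDiff v u), mul_comm]
  have hpos := two_sub_mul_inv_pos h1
  gcongr ?_ * ?_
  · exact pow_le_pow_of_le_one h0.le h1'.le hm
  · exact le_abs_signSeries_sub_of_apply_zero_ne h0 h1' (by
      simpa only [zero_add] using PiNat.apply_firstDiff_ne hne)

theorem isBinaryCoding_signSeries (h0 : 0 < ρ) (h1 : ρ < 1 / 2) :
    IsBinaryCoding ρ (signSeries ρ) where
  pos := h0
  lt_one := by linarith
  exists_dist_le := ⟨2 * (1 - ρ)⁻¹, mul_pos two_pos (inv_pos.2 (by linarith)),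
    fun _ _ _ hv => abs_signSeries_sub_le h0 (by linarith) hv⟩
  exists_mem_cylinder := by
    refine ⟨2 - 2 * ρ * (1 - ρ)⁻¹, two_sub_mul_inv_pos h1, fun u v l h => ?_⟩
    by_contra hv
    exact h.not_ge (le_abs_signSeries_sub h0 h1 fun hv' =>
      hv (PiNat.cylinder_anti u l.le_succ hv'))

theorem IsBinaryCoding.affine {F : (ℕ → Bool) → ℝ} (hF : IsBinaryCoding ρ F) {a : ℝ} (ha : a ≠ 0)
    (b : ℝ) : IsBinaryCoding ρ fun u => a * F u + b := by
  have ha' : 0 < |a| := abs_pos.2 ha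
  have hdist (x y : ℝ) : dist (a * x + b) (a * y + b) = |a| * dist x y := by
    rw [dist_add_right, Real.dist_eq, Real.dist_eq, ← mul_sub, abs_mul]
  obtain ⟨A, hA, hAF⟩ := hF.exists_dist_le
  obtain ⟨B, hB, hBF⟩ := hF.exists_mem_cylinder
  refine ⟨hF.pos, hF.lt_one, ⟨|a| * A, mul_pos ha' hA, fun u l v hv => ?_⟩,
    ⟨|a| * B, mul_pos ha' hB, fun u v l h => hBF u v l ?_⟩⟩
  · rw [hdist, mul_assoc]
    exact mul_le_mul_of_nonneg_left (hAF u l v hv) ha'.le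
  · rw [hdist, mul_assoc] at h
    exact lt_of_mul_lt_mul_left h ha'.le

end SignSeries

/-- The point of the Cantor set with ternary digits `2 u_0, 2 u_1, …`. -/
noncomputable def cantorPoint (u : ℕ → Bool) : ℝ :=
  ∑' i : ℕ, if u i then 2 * (1 / 3 : ℝ) ^ (i + 1) else 0

theorem hasSum_cantorPoint (u : ℕ → Bool) :
    HasSum (fun i : ℕ => if u i then 2 * (1 / 3 : ℝ) ^ (i + 1) else 0)
      (1 / 3 * signSeries (1 / 3) u + 1 / 2) := by
  have hsigns := (summable_signSeries (ρ := 1 / 3) (by norm_num) (by norm_num) u).hasSum.mul_left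
    (1 / 3)
  have hgeom := (hasSum_geometric_of_lt_one (r := (1 / 3 : ℝ)) (by norm_num) (by norm_num)).mul_left
    (1 / 3)
  have hterm : (fun i : ℕ => if u i then 2 * (1 / 3 : ℝ) ^ (i + 1) else 0) = fun i : ℕ =>
      1 / 3 * ((if u i then (1 : ℝ) else -1) * (1 / 3) ^ i) + 1 / 3 * (1 / 3) ^ i := by
    ext i
    split_ifs <;> ring
  rw [hterm, signSeries, show (1 / 2 : ℝ) = 1 / 3 * (1 - 1 / 3)⁻¹ by norm_num]
  exact hsigns.add hgeom

theorem cantorPoint_eq (u : ℕ → Bool) : cantorPoint u = 1 / 3 * signSeries (1 / 3) u + 1 / 2 :=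
  (hasSum_cantorPoint u).tsum_eq

theorem isBinaryCoding_cantorPoint : IsBinaryCoding (1 / 3) cantorPoint := by
  have h := (isBinaryCoding_signSeries (ρ := 1 / 3) (by norm_num) (by norm_num)).affine
    (a := 1 / 3) (by norm_num) (1 / 2)
  rwa [← funext cantorPoint_eq] at h

theorem ofDigits_eq_cantorPoint (u : ℕ → Bool) :
    Real.ofDigits (fun i => cond (u i) (2 : Fin 3) 0) = cantorPoint u := by
  refine tsum_congr fun i => ?_
  cases hu : u i <;> simp [Real.ofDigitsTerm, hu]

theorem range_cantorPoint : range cantorPoint = cantorSet := by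
  ext x
  rw [cantorSet_eq_zero_two_ofDigits]
  constructor
  · rintro ⟨u, rfl⟩
    exact ⟨fun i => cond (u i) 2 0, fun i => by cases hu : u i <;> simp [hu],
      ofDigits_eq_cantorPoint u⟩
  · rintro ⟨d, hd, rfl⟩
    refine ⟨fun i => d i = 2, ?_⟩
    rw [← ofDigits_eq_cantorPoint]
    congr 1
    ext i
    have := hd i
    generalize d i = e at *
    fin_cases e <;> simp_all

theorem cantorPoint_mem (u : ℕ → Bool) : cantorPoint u ∈ cantorSet :=
  range_cantorPoint ▸ mem_range_self u

theorem cantorPoint_eq_cantorLeft_add (u : ℕ → Bool) (k : ℕ) :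
    cantorPoint u = cantorLeft (fun i : Fin k => u i)
      + (1 / 3) ^ k * cantorPoint (fun i => u (i + k)) := by
  rw [cantorPoint, ← (hasSum_cantorPoint u).summable.sum_add_tsum_nat_add k, cantorPoint,
    ← tsum_mul_left, cantorLeft, Finset.sum_range]
  congr 2
  ext i
  split_ifs <;> ring

theorem cantorPoint_extendFalse {k : ℕ} (w : Fin k → Bool) :
    cantorPoint (extendFalse w) = cantorLeft w := by
  rw [cantorPoint_eq_cantorLeft_add _ k, funext (extendFalse_coe w)]
  simp [cantorPoint, extendFalse]

theorem cantorLeft_mem {k : ℕ} (w : Fin k → Bool) : cantorLeft w ∈ cantorSet :=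
  cantorPoint_extendFalse w ▸ cantorPoint_mem _

theorem mem_cylinder_of_abs_cantorPoint_sub_lt {u v : ℕ → Bool} {l : ℕ}
    (h : |cantorPoint v - cantorPoint u| < (1 / 3) ^ l) : v ∈ PiNat.cylinder u l := by
  obtain - | l := l
  · exact PiNat.cylinder_zero u ▸ mem_univ v
  by_contra hne
  have hle := le_abs_signSeries_sub (ρ := 1 / 3) (by norm_num) (by norm_num) hne
  rw [cantorPoint_eq, cantorPoint_eq, add_sub_add_right_eq_sub, ← mul_sub, abs_mul, pow_succ'] at h
  norm_num at hle h
  linarith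

theorem le_abs_cantorLeft_sub {k : ℕ} {w w' : Fin k → Bool} (h : w ≠ w') :
    (1 / 3 : ℝ) ^ k ≤ |cantorLeft w - cantorLeft w'| := by
  contrapose! h
  rw [← cantorPoint_extendFalse, ← cantorPoint_extendFalse] at h
  exact funext fun i => by
    simpa only [extendFalse_coe] using mem_cylinder_of_abs_cantorPoint_sub_lt h i i.isLt

theorem le_third_or_two_thirds_le_of_mem_cantorSet {z : ℝ} (hz : z ∈ cantorSet) :
    z ≤ 1 / 3 ∨ 2 / 3 ≤ z := by
  rw [cantorSet_eq_union_halves] at hz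
  rcases hz with ⟨y, hy, rfl⟩ | ⟨y, hy, rfl⟩ <;> have hy' := cantorSet_subset_unitInterval hy
  · exact Or.inl (by linarith [hy'.2])
  · exact Or.inr (by linarith [hy'.1])

theorem le_abs_sub_of_mem_middleNinth {k : ℕ} {w : Fin k → Bool} {y : ℝ} (hy : y ∈ middleNinth w)
    {x : ℝ} (hx : x ∈ cantorSet) : (1 / 3 : ℝ) ^ k / 9 ≤ |x - y| := by
  rw [← range_cantorPoint] at hx
  obtain ⟨u, rfl⟩ := hx
  rw [cantorPoint_eq_cantorLeft_add u k]
  have hz := cantorPoint_mem fun i => u (i + k)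
  generalize cantorPoint (fun i => u (i + k)) = z at hz
  have hp : (0 : ℝ) < (1 / 3) ^ k := by positivity
  obtain ⟨hz0, hz1⟩ := cantorSet_subset_unitInterval hz
  rw [le_abs]
  by_cases hw : (fun i : Fin k => u i) = w
  · rw [hw]
    rcases le_third_or_two_thirds_le_of_mem_cantorSet hz with h | h
    · exact Or.inr (by nlinarith [hy.1])
    · exact Or.inl (by nlinarith [hy.2])
  · rcases le_abs.1 (le_abs_cantorLeft_sub hw) with h | h
    · exact Or.inl (by nlinarith [hy.2])
    · exact Or.inr (by nlinarith [hy.1])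

theorem pairwise_disjoint_middleNinth (k : ℕ) :
    Pairwise (Function.onFun Disjoint (middleNinth : (Fin k → Bool) → Set ℝ)) := by
  refine fun w w' hne => Set.disjoint_left.2 fun y hy hy' => ?_
  have hp : (0 : ℝ) < (1 / 3) ^ k := by positivity
  rcases le_abs.1 (le_abs_cantorLeft_sub hne) with h | h <;> linarith [hy.1, hy.2, hy'.1, hy'.2]

theorem abs_cantorPoint_sub_le {k : ℕ} {u : ℕ → Bool} {y : ℝ}
    (hy : y ∈ middleNinth fun i : Fin k => u i) : |cantorPoint u - y| ≤ (1 / 3) ^ k := by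
  rw [cantorPoint_eq_cantorLeft_add u k, abs_le]
  obtain ⟨hz0, hz1⟩ := cantorSet_subset_unitInterval (cantorPoint_mem fun i => u (i + k))
  have hp : (0 : ℝ) < (1 / 3) ^ k := by positivity
  constructor <;> nlinarith [hy.1, hy.2]

theorem abs_cantorLeft_sub_le {k : ℕ} {w : Fin k → Bool} {y : ℝ} (hy : y ∈ middleNinth w) :
    |cantorLeft w - y| ≤ (1 / 3) ^ k := by
  rw [← cantorPoint_extendFalse]
  refine abs_cantorPoint_sub_le ?_
  rwa [funext (extendFalse_coe w)]

/-! ### Box dimension and packing dimension -/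

section BoxDimension

variable {X : Type*} [PseudoMetricSpace X] {A : Set X}

theorem upperBoxDim_le_of_eventually_le {K d : ℝ} (hK : 0 < K)
    (h : ∀ᶠ r : ℝ≥0 in 𝓝[>] 0,
      (Metric.externalCoveringNumber r A : ℝ≥0∞) ≤ ENNReal.ofReal (K * (r : ℝ) ^ (-d))) :
    upperBoxDim A ≤ (d : EReal) := by
  have hlim : Tendsto (fun r : ℝ≥0 => ((Real.log K / (-Real.log r) + d : ℝ) : EReal))
      (𝓝[>] 0) (𝓝 (d : EReal)) := by
    refine (continuous_coe_real_ereal.tendsto d).comp ?_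
    have hcoe : Tendsto (fun r : ℝ≥0 => (r : ℝ)) (𝓝[>] 0) (𝓝[>] 0) :=
      tendsto_nhdsWithin_iff.2 ⟨(NNReal.continuous_coe.tendsto 0).mono_left nhdsWithin_le_nhds,
        eventually_mem_nhdsWithin.mono fun r hr => NNReal.coe_pos.2 hr⟩
    have hlog := tendsto_neg_atBot_atTop.comp (Real.tendsto_log_nhdsGT_zero.comp hcoe)
    simpa using (hlog.const_div_atTop (Real.log K)).add_const d
  rw [upperBoxDim, ← hlim.limsup_eq]
  refine limsup_le_limsup ?_
  filter_upwards [h, Ioo_mem_nhdsGT one_pos] with r hr hr1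
  have hr0 : (0 : ℝ) < r := NNReal.coe_pos.2 hr1.1
  have hlog : 0 < -Real.log r := neg_pos.2 (Real.log_neg hr0 (by exact_mod_cast hr1.2))
  have hnum := ENNReal.log_monotone hr
  rw [ENNReal.log_ofReal_of_pos (by positivity), Real.log_mul hK.ne' (by positivity),
    Real.log_rpow hr0] at hnum
  refine (EReal.div_le_div_right_of_nonneg (by exact_mod_cast hlog.le) hnum).trans_eq ?_
  rw [← EReal.coe_div, neg_mul_comm, add_div, mul_div_cancel_right₀ _ hlog.ne']

theorem eventually_externalCoveringNumber_le_of_upperBoxDim_lt {d : ℝ}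
    (h : upperBoxDim A < (d : EReal)) : ∀ᶠ r : ℝ≥0 in 𝓝[>] 0,
      (Metric.externalCoveringNumber r A : ℝ≥0∞) ≤ ENNReal.ofReal ((r : ℝ) ^ (-d)) := by
  filter_upwards [eventually_lt_of_limsup_lt h, Ioo_mem_nhdsGT one_pos] with r hr hr1
  have hr0 : (0 : ℝ) < r := NNReal.coe_pos.2 hr1.1
  have hlog : 0 < -Real.log r := neg_pos.2 (Real.log_neg hr0 (by exact_mod_cast hr1.2))
  rw [← ENNReal.log_le_log_iff, ENNReal.log_ofReal_of_pos (by positivity), Real.log_rpow hr0]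
  refine ((EReal.div_le_iff_le_mul (by exact_mod_cast hlog) (EReal.coe_ne_top _)).1
    hr.le).trans_eq ?_
  rw [← EReal.coe_mul, neg_mul_comm, mul_comm]

theorem upperBoxDim_empty_le (d : ℝ) : upperBoxDim (∅ : Set X) ≤ (d : EReal) :=
  upperBoxDim_le_of_eventually_le one_pos (by simp)

theorem exists_finset_cover_of_externalCoveringNumber_le {r : ℝ≥0} {x : ℝ}
    (h : (Metric.externalCoveringNumber r A : ℝ≥0∞) ≤ ENNReal.ofReal x) :
    ∃ T : Finset X, A ⊆ ⋃ y ∈ T, Metric.closedBall y r ∧ (T.card : ℝ≥0∞) ≤ ENNReal.ofReal x := by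
  have htop : Metric.externalCoveringNumber r A ≠ ⊤ := fun htop => by simp [htop] at h
  obtain ⟨n, hn⟩ := ENat.ne_top_iff_exists.1 htop
  have hlt : Metric.externalCoveringNumber r A < (n + 1 : ℕ) := hn ▸ mod_cast n.lt_succ_self
  obtain ⟨C, hC⟩ := iInf_lt_iff.1 hlt
  obtain ⟨hcov, hC⟩ := iInf_lt_iff.1 hC
  have hfin : C.Finite := encard_lt_top_iff.1 (hC.trans (ENat.natCast_lt_top _))
  refine ⟨hfin.toFinset, by simpa using hcov.subset_iUnion_closedBall, le_trans ?_ h⟩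
  rw [hfin.encard_eq_coe_toFinset_card, Nat.cast_lt, Nat.lt_succ_iff] at hC
  rw [← hn]
  simpa using hC

theorem IsBinaryCoding.externalCoveringNumber_range_le {Y : Type*} [MetricSpace Y] {ρ : ℝ}
    {F : (ℕ → Bool) → Y} (hF : IsBinaryCoding ρ F) : ∃ K : ℝ, 0 < K ∧ ∀ (l : ℕ) (r : ℝ≥0),
      K * ρ ^ l ≤ r → Metric.externalCoveringNumber r (range F) ≤ (2 ^ l : ℕ) := by
  obtain ⟨K, hK, hKF⟩ := hF.exists_dist_le
  refine ⟨K, hK, fun l r hr => ?_⟩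
  have hcov : Metric.IsCover r (range F) (range fun w : Fin l → Bool => F (extendFalse w)) := by
    rintro _ ⟨u, rfl⟩
    refine ⟨_, ⟨fun i => u i, rfl⟩, ?_⟩
    change edist _ _ ≤ _
    rw [edist_nndist, ENNReal.coe_le_coe, ← NNReal.coe_le_coe, coe_nndist, dist_comm]
    exact (hKF u l _ (extendFalse_mem_cylinder u l)).trans hr
  refine hcov.externalCoveringNumber_le_encard.trans ?_
  rw [← image_univ]
  refine (encard_image_le _ _).trans ?_
  simp [encard_univ]

theorem IsBinaryCoding.upperBoxDim_range_le {Y : Type*} [MetricSpace Y] {ρ : ℝ}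
    {F : (ℕ → Bool) → Y} (hF : IsBinaryCoding ρ F) :
    upperBoxDim (range F) ≤ (treeDim ρ : EReal) := by
  obtain ⟨K, hK, hN⟩ := hF.externalCoveringNumber_range_le
  have h0 := hF.pos
  refine upperBoxDim_le_of_eventually_le (K := (ρ / K) ^ (-treeDim ρ)) (by positivity) ?_
  filter_upwards [Ioo_mem_nhdsGT (Real.toNNReal_pos.2 hK)] with r hr
  have hr0 : (0 : ℝ) < r := NNReal.coe_pos.2 hr.1
  have hrK : (r : ℝ) ≤ K := (Real.lt_toNNReal_iff_coe_lt.1 hr.2).le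
  obtain ⟨l, hl, hl'⟩ := exists_nat_pow_near_of_lt_one (x := r / K) (by positivity)
    ((div_le_one hK).2 hrK) h0 hF.lt_one
  calc (Metric.externalCoveringNumber r (range F) : ℝ≥0∞)
      ≤ ((2 ^ (l + 1) : ℕ) : ℕ∞) :=
        ENat.toENNReal_mono (hN (l + 1) r ((lt_div_iff₀' hK).1 hl).le)
    _ = ENNReal.ofReal (((ρ ^ (l + 1)) ^ treeDim ρ)⁻¹) := by
        rw [pow_rpow_treeDim h0 hF.lt_one, one_div, inv_pow, inv_inv,
          ENNReal.ofReal_pow zero_le_two]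
        simp
    _ ≤ ENNReal.ofReal ((ρ / K) ^ (-treeDim ρ) * (r : ℝ) ^ (-treeDim ρ)) := by
        rw [← Real.mul_rpow (by positivity) hr0.le, ← Real.rpow_neg (by positivity)]
        refine ENNReal.ofReal_le_ofReal (Real.rpow_le_rpow_of_nonpos (by positivity) ?_
          (neg_nonpos.2 (treeDim_pos h0 hF.lt_one).le))
        rw [div_mul_eq_mul_div, mul_div_assoc, pow_succ']
        gcongr

end BoxDimension

section PackingDimension

variable {X : Type*} [MetricSpace X] {A : Set X}

theorem hausdorffMeasure_eq_zero_of_eventually_le [MeasurableSpace X] [BorelSpace X] {d u : ℝ}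
    (hu : 0 ≤ u) (hdu : d < u)
    (h : ∀ᶠ r : ℝ≥0 in 𝓝[>] 0,
      (Metric.externalCoveringNumber r A : ℝ≥0∞) ≤ ENNReal.ofReal ((r : ℝ) ^ (-d))) :
    Measure.hausdorffMeasure u A = 0 := by
  obtain ⟨T, hT⟩ := (h.mono fun r hr =>
    exists_finset_cover_of_externalCoveringNumber_le hr).choice
  have hdiam (r : ℝ≥0) (y : X) : Metric.ediam (Metric.closedBall y r) ≤ 2 * (r : ℝ≥0∞) := by
    rw [← Metric.closedEBall_coe]
    exact Metric.ediam_closedEBall_le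
  have hdiam_lim : Tendsto (fun r : ℝ≥0 => 2 * (r : ℝ≥0∞)) (𝓝[>] 0) (𝓝 0) := by
    have h := ENNReal.Tendsto.const_mul (a := 2) (ENNReal.continuous_coe.tendsto 0)
      (Or.inr (by simp))
    simpa using h.mono_left nhdsWithin_le_nhds
  have hsum_lim : Tendsto (fun r : ℝ≥0 => ENNReal.ofReal (2 ^ u * (r : ℝ) ^ (u - d)))
      (𝓝[>] 0) (𝓝 0) := by
    have h := ((NNReal.continuous_coe.tendsto 0).rpow_const (p := u - d)
      (Or.inr (by linarith))).const_mul (2 ^ u)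
    rw [NNReal.coe_zero, Real.zero_rpow (by linarith), mul_zero] at h
    simpa using ENNReal.tendsto_ofReal (h.mono_left nhdsWithin_le_nhds)
  refine le_antisymm ((Measure.hausdorffMeasure_le_liminf_sum u A _ hdiam_lim
    (fun r (y : T r) => Metric.closedBall (y : X) r) (Eventually.of_forall fun r y => hdiam r y)
    (hT.mono fun r h => ?_)).trans ?_) zero_le
  · simpa [iUnion_subtype] using h.1
  rw [← hsum_lim.liminf_eq]
  refine liminf_le_liminf ?_
  filter_upwards [hT, self_mem_nhdsWithin] with r hTr hr0
  have hr0 : (0 : ℝ) < r := NNReal.coe_pos.2 hr0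
  calc ∑ y : T r, Metric.ediam (Metric.closedBall (y : X) r) ^ u
      ≤ ∑ _y : T r, (2 * (r : ℝ≥0∞)) ^ u :=
        Finset.sum_le_sum fun y _ => ENNReal.rpow_le_rpow (hdiam r y) hu
    _ = (T r).card * (2 * (r : ℝ≥0∞)) ^ u := by simp
    _ ≤ ENNReal.ofReal ((r : ℝ) ^ (-d)) * ENNReal.ofReal (2 * r) ^ u := by
        rw [ENNReal.ofReal_mul zero_le_two, ENNReal.ofReal_ofNat, ENNReal.ofReal_coe_nnreal]
        gcongr
        exact hTr.2
    _ = ENNReal.ofReal (2 ^ u * (r : ℝ) ^ (u - d)) := by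
        rw [ENNReal.ofReal_rpow_of_nonneg (by positivity) hu, ← ENNReal.ofReal_mul (by positivity),
          Real.mul_rpow zero_le_two hr0.le, mul_left_comm, ← Real.rpow_add hr0, neg_add_eq_sub]

theorem dimH_le_of_upperBoxDim_le {t : ℝ≥0∞} (h : upperBoxDim A ≤ (t : EReal)) : dimH A ≤ t := by
  borelize X
  refine le_of_forall_gt_imp_ge_of_dense fun u htu => ?_
  rcases eq_or_ne u ⊤ with rfl | hu
  · exact le_top
  lift u to ℝ≥0 using hu
  obtain ⟨w, htw, hwu⟩ := exists_between htu
  lift w to ℝ≥0 using (hwu.trans ENNReal.coe_lt_top).ne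
  refine dimH_le_of_hausdorffMeasure_ne_top (ne_of_eq_of_ne
    (hausdorffMeasure_eq_zero_of_eventually_le (d := w) u.2 (by exact_mod_cast hwu) ?_)
    ENNReal.zero_ne_top)
  exact eventually_externalCoveringNumber_le_of_upperBoxDim_lt
    (h.trans_lt (EReal.coe_ennreal_lt_coe_ennreal_iff.2 htw))

theorem dimH_le_packingDim (S : Set X) : dimH S ≤ packingDim S := by
  refine le_sInf ?_
  rintro t ⟨A, hA, hS⟩
  refine (dimH_mono hS).trans ?_
  rw [dimH_iUnion]
  exact iSup_le fun i => dimH_le_of_upperBoxDim_le (hA i)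

theorem packingDim_iUnion_le {Y ι : Type*} [PseudoMetricSpace Y] [Countable ι] [Nonempty ι]
    {A : ι → Set Y} {t : ℝ} (hA : ∀ i, upperBoxDim (A i) ≤ (t : EReal)) :
    packingDim (⋃ i, A i) ≤ ENNReal.ofReal t := by
  obtain ⟨e, he⟩ := exists_surjective_nat ι
  refine sInf_le ⟨fun n => A (e n), fun n => (hA (e n)).trans ?_, (he.iUnion_comp A).ge⟩
  rw [EReal.coe_ennreal_ofReal]
  exact_mod_cast le_max_left t 0

theorem packingDim_empty {Y : Type*} [PseudoMetricSpace Y] : packingDim (∅ : Set Y) = 0 := by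
  have h := packingDim_iUnion_le (A := fun _ : Unit => (∅ : Set Y)) fun _ => upperBoxDim_empty_le 0
  simpa using h

theorem dimH_iUnion_eq_and_packingDim_iUnion_eq {ι : Type*} [Countable ι] [Nonempty ι]
    {A : ι → Set X} {t : ℝ} (hA : ∀ i, upperBoxDim (A i) ≤ (t : EReal))
    (ht : ENNReal.ofReal t ≤ dimH (⋃ i, A i)) :
    dimH (⋃ i, A i) = ENNReal.ofReal t ∧ packingDim (⋃ i, A i) = ENNReal.ofReal t :=
  have hle := packingDim_iUnion_le hA
  ⟨((dimH_le_packingDim _).trans hle).antisymm ht, hle.antisymm (ht.trans (dimH_le_packingDim _))⟩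

end PackingDimension

/-! ### Forcing digits in sparse blocks -/

section Fill

open scoped Function

open Classical in
/-- The sequence that agrees with `σ` on `free` and whose terms at the other positions `n` are
computed by `rule n` from its terms before `n`. -/
noncomputable def fill (free : Set ℕ) (rule : (n : ℕ) → (Fin n → Bool) → Bool) (σ : ℕ → Bool)
    (n : ℕ) : Bool :=
  if n ∈ free then σ n else rule n fun i => fill free rule σ i
termination_by n
decreasing_by exact i.isLt

variable {free : Set ℕ} {rule : (n : ℕ) → (Fin n → Bool) → Bool}

theorem fill_of_mem (σ : ℕ → Bool) {n : ℕ} (hn : n ∈ free) : fill free rule σ n = σ n := by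
  rw [fill, if_pos hn]

theorem fill_of_notMem (σ : ℕ → Bool) {n : ℕ} (hn : n ∉ free) :
    fill free rule σ n = rule n fun i => fill free rule σ i := by
  rw [fill, if_neg hn]

theorem measurable_fill : Measurable (fill free rule) := by
  refine measurable_pi_iff.2 fun n => ?_
  induction n using Nat.strong_induction_on with
  | _ n ih =>
    by_cases hn : n ∈ free
    · simpa only [fill_of_mem _ hn] using measurable_pi_apply n
    · simp only [fill_of_notMem _ hn]
      exact (measurable_of_finite (rule n)).comp (measurable_pi_iff.2 fun i => ih i i.isLt)

theorem exists_measurable_forall_mem_of_blocks {k m : ℕ → ℕ}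
    (hkm : Pairwise (Disjoint on fun j => Ico (k j) (m j))) {G : ℕ → Set (ℕ → Bool)}
    (hG : ∀ j, ∀ u ∈ G j, PiNat.cylinder u (m j) ⊆ G j)
    (h : ∀ j w, (PiNat.cylinder w (k j) ∩ G j).Nonempty) :
    ∃ g : (ℕ → Bool) → ℕ → Bool, Measurable g ∧ (∀ σ j, g σ ∈ G j) ∧
      ∀ σ i, (∀ j, i ∉ Ico (k j) (m j)) → g σ i = σ i := by
  choose ext hext hextG using h
  have hJ (i : ℕ) : ∃ j, ∀ j', i ∈ Ico (k j') (m j') → j' = j := by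
    by_cases hi : ∃ j, i ∈ Ico (k j) (m j)
    · obtain ⟨j, hj⟩ := hi
      exact ⟨j, fun j' hj' => hkm.eq (not_disjoint_iff.2 ⟨i, hj', hj⟩)⟩
    · exact ⟨0, fun j' hj' => absurd ⟨j', hj'⟩ hi⟩
  choose J hJ using hJ
  let rule (n : ℕ) (p : Fin n → Bool) : Bool :=
    ext (J n) (extendFalse fun i : Fin (k (J n)) => extendFalse p i) n
  refine ⟨fill {i | ∀ j, i ∉ Ico (k j) (m j)} rule, measurable_fill, fun σ j => ?_,
    fun σ i hi => fill_of_mem σ hi⟩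
  set u := fill {i | ∀ j, i ∉ Ico (k j) (m j)} rule σ with hu
  refine hG j _ (hextG j (extendFalse fun i : Fin (k j) => u i)) fun i hi => ?_
  rcases lt_or_ge i (k j) with hik | hik
  · rw [hext j _ i hik, extendFalse_of_lt _ hik]
  · have hblock : i ∈ Ico (k j) (m j) := ⟨hik, hi⟩
    have hforced : i ∉ {i | ∀ j, i ∉ Ico (k j) (m j)} := fun hfree => hfree j hblock
    have hprefix : (fun n : Fin (k j) => extendFalse (fun n : Fin i => u n) n) =
        fun n : Fin (k j) => u n :=
      funext fun n => extendFalse_of_lt _ (n.isLt.trans_le hik)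
    rw [hu, fill_of_notMem σ hforced, ← hu]
    obtain rfl := hJ i j hblock
    exact congrArg (fun w => ext (J i) (extendFalse w) i) hprefix

end Fill

section SparseBlocks

open scoped Function

theorem exists_strictMono_sparse {P : ℕ → ℕ → Prop} (hP : ∀ j, ∀ᶠ n in atTop, P j n) (M : ℕ → ℕ) :
    ∃ k : ℕ → ℕ, StrictMono k ∧ (∀ j, P j (k j)) ∧ ∀ i j, i < j → M (k i) ≤ k j := by
  obtain ⟨f, -, hf⟩ := exists_seq_of_forall_finset_exists (fun _ : ℕ => True)
    (fun x y => x < y ∧ M x ≤ y) fun s _ =>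
      ⟨s.sup fun x => max (x + 1) (M x), trivial, fun x hx =>
        have h := Finset.le_sup (f := fun x => max (x + 1) (M x)) hx
        ⟨(le_max_left _ _).trans h, (le_max_right _ _).trans h⟩⟩
  have hmono : StrictMono f := fun i j hij => (hf i j hij).1
  obtain ⟨φ, hφ, hPφ⟩ := extraction_forall_of_eventually fun j =>
    hmono.tendsto_atTop.eventually (hP j)
  exact ⟨f ∘ φ, hmono.comp hφ, hPφ, fun i j hij => (hf _ _ (hφ hij)).2⟩

variable {k m : ℕ → ℕ} {N : ℕ}

theorem exists_Ico_union_Ico_disjoint_blocks (hN : 0 < N) (hk : StrictMono k)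
    (hkm : ∀ j, k j ≤ m j) (hsparse : ∀ i j, i < j → N * m i ≤ k j) {l j₀ : ℕ} (hl : k j₀ ≤ l) :
    ∃ j, k j ≤ l ∧ ∀ x ∈ Finset.Ico (k j / N) (k j) ∪ Finset.Ico (m j) l,
      ∀ i, x ∉ Ico (k i) (m i) := by
  have hj₀ : j₀ ≤ l := (hk.id_le j₀).trans hl
  refine ⟨Nat.findGreatest (k · ≤ l) l, Nat.findGreatest_spec (P := (k · ≤ l)) hj₀ hl, ?_⟩
  have hlast (i : ℕ) (hi : k i ≤ l) : i ≤ Nat.findGreatest (k · ≤ l) l :=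
    Nat.le_findGreatest ((hk.id_le i).trans hi) hi
  generalize Nat.findGreatest (k · ≤ l) l = j at hlast ⊢
  have hbefore (i : ℕ) (hi : i < j) : m i ≤ k j / N :=
    (Nat.le_div_iff_mul_le hN).2 (mul_comm N (m i) ▸ hsparse i j hi)
  intro x hx i hi
  have hdiv := Nat.div_le_self (k j) N
  have := hkm j
  rw [Finset.mem_union, Finset.mem_Ico, Finset.mem_Ico] at hx
  rw [Set.mem_Ico] at hi
  rcases lt_trichotomy i j with hij | rfl | hij
  · have := hbefore i hij
    lia
  · lia
  · have := hk hij
    have := mt (hlast i) (by lia)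
    lia

-- The blocks before the `j`-th one lie below `k j / N`, so only the last block that starts before
-- `l` takes more than a small share of the first `l` positions.
theorem le_card_notMem_blocks {θ a : ℝ} (hN : 0 < N) (ha : 0 ≤ a) (ha1 : a ≤ 1)
    (hθ : a * θ ≤ 1 - 1 / N) (hk : StrictMono k) (hkm : ∀ j, k j ≤ m j)
    (hm : ∀ j, (m j : ℝ) ≤ θ * k j + 1) (hsparse : ∀ i j, i < j → N * m i ≤ k j) {l : ℕ}
    {S : Finset ℕ} (hS : ∀ i < l, (∀ j, i ∉ Ico (k j) (m j)) → i ∈ S) : a * l - 1 ≤ S.card := by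
  by_cases hl : ∀ j, l < k j
  · have hsub : Finset.range l ⊆ S := fun i hi =>
      hS i (Finset.mem_range.1 hi) fun j hj =>
        (hj.1.trans_lt (Finset.mem_range.1 hi)).not_gt (hl j)
    have hcard : (l : ℝ) ≤ S.card := by simpa using Finset.card_le_card hsub
    nlinarith [l.cast_nonneg (α := ℝ)]
  push Not at hl
  obtain ⟨j₀, hj₀⟩ := hl
  obtain ⟨j, hjl, hj⟩ := exists_Ico_union_Ico_disjoint_blocks hN hk hkm hsparse hj₀
  have hsub : Finset.Ico (k j / N) (k j) ∪ Finset.Ico (m j) l ⊆ S := fun x hx =>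
    hS x (by rw [Finset.mem_union, Finset.mem_Ico, Finset.mem_Ico] at hx; lia) (hj x hx)
  have hdisj : Disjoint (Finset.Ico (k j / N) (k j)) (Finset.Ico (m j) l) :=
    Finset.disjoint_left.2 fun x hx hx' => by
      have := hkm j
      rw [Finset.mem_Ico] at hx hx'
      lia
  have hcard := Finset.card_le_card hsub
  rw [Finset.card_union_of_disjoint hdisj, Nat.card_Ico, Nat.card_Ico] at hcard
  have hcard' : (k j : ℝ) - k j / N + ((l - m j : ℕ) : ℝ) ≤ S.card := by
    refine le_trans ?_ (Nat.cast_le.2 hcard)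
    rw [Nat.cast_add, Nat.cast_sub (Nat.div_le_self _ _)]
    gcongr
    exact Nat.cast_div_le
  have hlm : (l : ℝ) ≤ m j + (l - m j : ℕ) := by exact_mod_cast (by lia : l ≤ m j + (l - m j))
  calc a * l - 1 ≤ a * (θ * k j + 1 + (l - m j : ℕ)) - 1 := by
        have := hm j
        gcongr
        linarith
    _ = a * θ * k j + a * (l - m j : ℕ) + (a - 1) := by ring
    _ ≤ (1 - 1 / N) * k j + 1 * (l - m j : ℕ) + 0 := by
        gcongr
        linarith
    _ = (k j : ℝ) - k j / N + ((l - m j : ℕ) : ℝ) := by ring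
    _ ≤ S.card := hcard'

-- Toss coins outside sparse blocks `[k j, M (k j))` and use the `j`-th block to reach
-- `G j (M (k j))`.
theorem exists_measure_ae_forall_exists_mem {G : ℕ → ℕ → Set (ℕ → Bool)}
    (hG : ∀ j m, ∀ u ∈ G j m, PiNat.cylinder u m ⊆ G j m) {M : ℕ → ℕ} {θ a : ℝ}
    (hM : ∀ k, (M k : ℝ) ≤ θ * k + 1) (hkM : ∀ k, k ≤ M k) (ha : 0 ≤ a) (ha1 : a ≤ 1)
    (haθ : a * θ < 1) (h : ∀ j, ∀ᶠ k in atTop, ∀ w, (PiNat.cylinder w k ∩ G j (M k)).Nonempty) :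
    ∃ κ : Measure (ℕ → Bool), IsProbabilityMeasure κ ∧
      (∀ u l, κ (PiNat.cylinder u l) ≤ 2 * coinMeasure (PiNat.cylinder u l) ^ a) ∧
      ∀ᵐ u ∂κ, ∀ j, ∃ m, u ∈ G j m := by
  classical
  obtain ⟨N, hN⟩ := exists_nat_one_div_lt (sub_pos.2 haθ)
  obtain ⟨k, hk, hhit, hsparse⟩ := exists_strictMono_sparse h fun n => (N + 1) * M n
  have hblocks (i j : ℕ) (hij : i < j) : M (k i) ≤ k j :=
    (Nat.le_mul_of_pos_left _ N.succ_pos).trans (hsparse i j hij)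
  have hdisj : Pairwise (Disjoint on fun j => Ico (k j) (M (k j))) := by
    refine (pairwise_disjoint_on _).2 fun i j hij => disjoint_left.2 fun x hx hx' => ?_
    exact ((hblocks i j hij).trans hx'.1).not_gt hx.2
  obtain ⟨g, hg, hgG, hgfree⟩ := exists_measurable_forall_mem_of_blocks hdisj
    (G := fun j => G j (M (k j))) (fun j => hG j _) hhit
  refine ⟨coinMeasure.map g, Measure.isProbabilityMeasure_map hg.aemeasurable, fun u l => ?_, ?_⟩
  · set S := (Finset.range l).filter fun i => ∀ j, i ∉ Ico (k j) (M (k j)) with hS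
    have hsub : g ⁻¹' PiNat.cylinder u l ⊆ {σ | ∀ i ∈ S, σ i = u i} := fun σ hσ i hi => by
      rw [hS, Finset.mem_filter, Finset.mem_range] at hi
      rw [← hgfree σ i hi.2, hσ i hi.1]
    have hcard : a * l - 1 ≤ S.card :=
      le_card_notMem_blocks N.succ_pos ha ha1 (by push_cast; linarith) hk (fun j => hkM _)
        (fun j => hM _) hsparse fun i hi hi' => Finset.mem_filter.2 ⟨Finset.mem_range.2 hi, hi'⟩
    rw [Measure.map_apply hg (measurableSet_cylinder u l), coinMeasure_cylinder]
    calc coinMeasure (g ⁻¹' PiNat.cylinder u l) ≤ 2⁻¹ ^ (S.card : ℝ) := by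
          rw [ENNReal.rpow_natCast, ← coinMeasure_setOf_eq_on S u]
          exact measure_mono hsub
      _ ≤ 2⁻¹ ^ (a * l - 1) := ENNReal.rpow_le_rpow_of_exponent_ge (by simp) hcard
      _ = 2 * (2⁻¹ ^ l) ^ a := by
          rw [ENNReal.rpow_sub _ _ (by simp) (by simp), ENNReal.rpow_one, div_eq_mul_inv, inv_inv,
            mul_comm, mul_comm a, ENNReal.rpow_natCast_mul]
  · refine (ae_map_iff hg.aemeasurable ?_).2 (ae_of_all _ fun σ j => ⟨M (k j), hgG σ j⟩)
    simp only [ofPred_forall, ofPred_exists, ofPred_mem_eq]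
    refine .iInter fun j => .iUnion fun m => IsOpen.measurableSet (isOpen_iff_mem_nhds.2 ?_)
    exact fun u hu => mem_of_superset
      ((PiNat.isOpen_cylinder _ u m).mem_nhds (PiNat.self_mem_cylinder u m)) (hG j m u hu)

end SparseBlocks

/-! ### Lower bounds for random limsup sets -/

section AlmostEverywhere

variable {Ω : Type*} [MeasurableSpace Ω] {P : Measure Ω} {f : Ω → ℝ≥0∞} {x : ℝ}

theorem ae_ofReal_le_of_forall_lt
    (h : ∀ t : ℝ, 0 < t → t < x → ∀ᵐ ω ∂P, ENNReal.ofReal t ≤ f ω) :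
    ∀ᵐ ω ∂P, ENNReal.ofReal x ≤ f ω := by
  obtain ⟨t, -, htx, ht⟩ := exists_seq_strictMono_tendsto x
  have hseq (n : ℕ) : ∀ᵐ ω ∂P, ENNReal.ofReal (t n) ≤ f ω := by
    rcases le_or_gt (t n) 0 with h0 | h0
    · simp [ENNReal.ofReal_of_nonpos h0]
    · exact h _ h0 (htx n)
  filter_upwards [ae_all_iff.2 hseq] with ω hω
  exact le_of_tendsto' (ENNReal.tendsto_ofReal ht) hω

theorem ae_le_ofReal_of_forall_gt
    (h : ∀ t : ℝ, 0 < t → x < t → ∀ᵐ ω ∂P, f ω ≤ ENNReal.ofReal t) :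
    ∀ᵐ ω ∂P, f ω ≤ ENNReal.ofReal x := by
  obtain ⟨t, -, htx, ht⟩ := exists_seq_strictAnti_tendsto (max x 0)
  have hseq : ∀ᵐ ω ∂P, ∀ n, f ω ≤ ENNReal.ofReal (t n) := ae_all_iff.2 fun n =>
    h _ ((le_max_right _ _).trans_lt (htx n)) ((le_max_left _ _).trans_lt (htx n))
  filter_upwards [hseq] with ω hω
  simpa [ENNReal.ofReal_max] using ge_of_tendsto' (ENNReal.tendsto_ofReal ht) hω

end AlmostEverywhere

/-- The words of length `m` that agree with the word `w` at their common positions. -/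
def extensions {k : ℕ} (w : Fin k → Bool) (m : ℕ) : Finset (Fin m → Bool) :=
  Fintype.piFinset fun i : Fin m => if h : (i : ℕ) < k then {w ⟨i, h⟩} else Finset.univ

theorem mem_extensions {k m : ℕ} {w : Fin k → Bool} {u : Fin m → Bool} :
    u ∈ extensions w m ↔ ∀ (i : Fin m) (h : (i : ℕ) < k), u i = w ⟨i, h⟩ := by
  rw [extensions, Fintype.mem_piFinset]
  refine forall_congr' fun i => ?_
  split_ifs with h <;> simp [h]

theorem card_extensions {k m : ℕ} (hkm : k ≤ m) (w : Fin k → Bool) :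
    (extensions w m).card = 2 ^ (m - k) := by
  rw [extensions, Fintype.card_piFinset]
  calc ∏ i : Fin m, (if h : (i : ℕ) < k then {w ⟨i, h⟩} else Finset.univ : Finset Bool).card
      = ∏ i : Fin m, if (i : ℕ) < k then 1 else 2 :=
        Finset.prod_congr rfl fun i _ => by split_ifs <;> simp
    _ = ∏ i ∈ Finset.range m, if i < k then 1 else 2 :=
        Fin.prod_univ_eq_prod_range (fun i : ℕ => if i < k then 1 else 2) m
    _ = 2 ^ (m - k) := by
        rw [← Finset.prod_range_mul_prod_Ico _ hkm,
          Finset.prod_congr rfl fun i hi => if_pos (Finset.mem_range.1 hi),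
          Finset.prod_congr rfl fun i hi => if_neg (Finset.mem_Ico.1 hi).1.not_gt]
        simp

section BorelCantelli

variable {X : Type*} [MeasurableSpace X] {μ : Measure X}

theorem ofReal_le_measure_biUnion_extensions {k m : ℕ} (hkm : k ≤ m) (w : Fin k → Bool)
    {V : (Fin m → Bool) → Set X} (hVm : ∀ u, MeasurableSet (V u))
    (hVd : Pairwise (Function.onFun Disjoint V)) {p : ℝ} (hV : ∀ u, ENNReal.ofReal p ≤ μ (V u)) :
    ENNReal.ofReal (2 ^ (m - k) * p) ≤ μ (⋃ u ∈ extensions w m, V u) := by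
  rw [measure_biUnion_finset (fun u _ v _ huv => hVd huv) fun u _ => hVm u]
  refine le_trans (le_of_eq ?_) (Finset.card_nsmul_le_sum _ _ _ fun u _ => hV u)
  rw [card_extensions hkm, nsmul_eq_mul, ENNReal.ofReal_mul (by positivity),
    ENNReal.ofReal_pow zero_le_two, ENNReal.ofReal_ofNat, Nat.cast_pow, Nat.cast_ofNat]

variable [IsProbabilityMeasure μ]

theorem infinitePi_forall_notMem_le {V : Set X} (hV : MeasurableSet V) {p : ℝ} (hp : 0 ≤ p)
    (hpV : ENNReal.ofReal p ≤ μ V) (j N : ℕ) :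
    (Measure.infinitePi fun _ : ℕ => μ) {ω | ∀ n ∈ Finset.Ico j N, ω n ∉ V} ≤
      ENNReal.ofReal (Real.exp (-(p * (N - j : ℕ)))) := by
  have hpi : {ω : ℕ → X | ∀ n ∈ Finset.Ico j N, ω n ∉ V} =
      ((Finset.Ico j N : Finset ℕ) : Set ℕ).pi fun _ => Vᶜ := by
    ext ω
    simp [Set.mem_pi]
  rw [hpi, Measure.infinitePi_pi _ fun _ _ => hV.compl, Finset.prod_const, Nat.card_Ico,
    prob_compl_eq_one_sub hV, mul_comm, ← mul_neg, Real.exp_nat_mul,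
    ENNReal.ofReal_pow (Real.exp_pos _).le]
  gcongr
  calc 1 - μ V ≤ 1 - ENNReal.ofReal p := by gcongr
    _ = ENNReal.ofReal (1 - p) := by rw [ENNReal.ofReal_sub _ hp, ENNReal.ofReal_one]
    _ ≤ ENNReal.ofReal (Real.exp (-p)) :=
        ENNReal.ofReal_le_ofReal (by linarith [Real.add_one_le_exp (-p)])

theorem ae_eventually_notMem_of_eventually_le {Ω : Type*} [MeasurableSpace Ω] {P : Measure Ω}
    {S : ℕ → Set Ω} (hS : ∀ᶠ k in atTop, P (S k) ≤ 2⁻¹ ^ k) : ∀ᵐ ω ∂P, ∀ᶠ k in atTop, ω ∉ S k := by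
  obtain ⟨K, hK⟩ := eventually_atTop.1 hS
  have hsum : ∑' k, P (S (k + K)) ≠ ⊤ := by
    refine ne_top_of_le_ne_top (b := ∑' k : ℕ, (2⁻¹ : ℝ≥0∞) ^ k) ?_ (ENNReal.tsum_le_tsum fun k =>
      (hK (k + K) (Nat.le_add_left K k)).trans
        (pow_le_pow_right_of_le_one' (by simp) (Nat.le_add_right k K)))
    rw [ENNReal.tsum_geometric]
    simp
  filter_upwards [ae_eventually_notMem hsum] with ω hω
  rw [← map_add_atTop_eq_nat K]
  exact hω

theorem ae_eventually_forall_exists_mem {V : (k : ℕ) → (Fin k → Bool) → Set X}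
    (hVm : ∀ k w, MeasurableSet (V k w)) {p : ℕ → ℝ} (hp : ∀ k, 0 ≤ p k)
    (hpV : ∀ k w, ENNReal.ofReal (p k) ≤ μ (V k w)) {j : ℕ} {N : ℕ → ℕ}
    (hN : ∀ᶠ k in atTop, 2 ^ k * Real.exp (-(p k * (N k - j : ℕ))) ≤ (1 / 2) ^ k) :
    ∀ᵐ ω ∂(Measure.infinitePi fun _ : ℕ => μ), ∀ᶠ k in atTop, ∀ w : Fin k → Bool,
      ∃ n ∈ Finset.Ico j (N k), ω n ∈ V k w := by
  have hbad : ∀ᶠ k in atTop, (Measure.infinitePi fun _ : ℕ => μ)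
      (⋃ w : Fin k → Bool, {ω | ∀ n ∈ Finset.Ico j (N k), ω n ∉ V k w}) ≤ 2⁻¹ ^ k := by
    filter_upwards [hN] with k hk
    calc _ ≤ ∑ w : Fin k → Bool, (Measure.infinitePi fun _ : ℕ => μ)
            {ω | ∀ n ∈ Finset.Ico j (N k), ω n ∉ V k w} := measure_iUnion_fintype_le _ _
      _ ≤ ∑ _w : Fin k → Bool, ENNReal.ofReal (Real.exp (-(p k * (N k - j : ℕ)))) :=
          Finset.sum_le_sum fun w _ =>
            infinitePi_forall_notMem_le (hVm k w) (hp k) (hpV k w) j (N k)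
      _ = ENNReal.ofReal (2 ^ k * Real.exp (-(p k * (N k - j : ℕ)))) := by
          rw [ENNReal.ofReal_mul (by positivity), ENNReal.ofReal_pow zero_le_two]
          simp
      _ ≤ ENNReal.ofReal ((1 / 2) ^ k) := ENNReal.ofReal_le_ofReal hk
      _ = 2⁻¹ ^ k := by
          rw [ENNReal.ofReal_pow (by norm_num), one_div, ENNReal.ofReal_inv_of_pos two_pos,
            ENNReal.ofReal_ofNat]
  filter_upwards [ae_eventually_notMem_of_eventually_le hbad] with ω hω
  filter_upwards [hω] with k hk w
  simp only [mem_iUnion, not_exists] at hk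
  by_contra! h
  exact hk w h

end BorelCantelli

section HitCount

theorem eventually_two_pow_mul_exp_le {c γ : ℝ} (hc : 0 < c) (hγ : 1 < γ) :
    ∀ᶠ k : ℕ in atTop, (2 : ℝ) ^ k * Real.exp (-(c * γ ^ k)) ≤ (1 / 2) ^ k := by
  have hlog : 0 < Real.log 4 := Real.log_pos (by norm_num)
  have hlim := tendsto_pow_const_div_const_pow_of_one_lt 1 hγ
  filter_upwards [hlim.eventually (ge_mem_nhds (div_pos hc hlog))] with k hk
  rw [pow_one, div_le_div_iff₀ (by positivity) hlog] at hk
  calc (2 : ℝ) ^ k * Real.exp (-(c * γ ^ k)) ≤ 2 ^ k * Real.exp (-(k * Real.log 4)) := by gcongr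
    _ = (1 / 2) ^ k := by
      rw [Real.exp_neg, ← Real.log_pow, Real.exp_log (by positivity), ← inv_pow, ← mul_pow]
      norm_num

theorem eventually_half_le_floor_sub {f : ℕ → ℝ} (hf : Tendsto f atTop atTop) (j : ℕ) :
    ∀ᶠ k in atTop, f k / 2 ≤ ((⌊f k⌋₊ - j : ℕ) : ℝ) := by
  filter_upwards [hf.eventually_ge_atTop (2 * (j + 1))] with k hk
  have hsub : (⌊f k⌋₊ : ℝ) ≤ ((⌊f k⌋₊ - j : ℕ) : ℝ) + j := by
    exact_mod_cast le_tsub_add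
  linarith [Nat.lt_floor_add_one (f k)]

variable {ρ D s c A θ : ℝ} {M : ℕ → ℕ}

-- The right side counts `2 ^ (m - k)` disjoint sets of measure at least `c ρ ^ (m D)` and half of
-- the `(A ρ ^ m) ^ (-s)` centres whose balls have radius at least `A ρ ^ m`.
theorem le_expected_hits (h0 : 0 < ρ) (h1 : ρ < 1) (hs : 0 ≤ s - (D - treeDim ρ)) (hc : 0 ≤ c)
    (hA : 0 < A) {k m : ℕ} (hkm : k ≤ m) (hm : θ * k ≤ m) :
    c * A ^ (-s) / 2 * (ρ ^ (-((s - (D - treeDim ρ)) * θ)) / 2) ^ k ≤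
      2 ^ (m - k) * (c * (ρ ^ m) ^ D) * ((A * ρ ^ m) ^ (-s) / 2) := by
  have hx : 0 < ρ ^ m := pow_pos h0 m
  have hcard : (2 : ℝ) ^ (m - k) = (ρ ^ m) ^ (-treeDim ρ) / 2 ^ k := by
    rw [pow_sub₀ _ two_ne_zero hkm, Real.rpow_neg hx.le, pow_rpow_treeDim h0 h1, one_div, inv_pow,
      inv_inv, div_eq_mul_inv]
  have hpow : ρ ^ (-((s - (D - treeDim ρ)) * θ) * k) ≤ (ρ ^ m) ^ (-(s - (D - treeDim ρ))) := by
    rw [← Real.rpow_natCast ρ, ← Real.rpow_mul h0.le]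
    refine Real.rpow_le_rpow_of_exponent_ge h0 h1.le ?_
    nlinarith
  calc c * A ^ (-s) / 2 * (ρ ^ (-((s - (D - treeDim ρ)) * θ)) / 2) ^ k
      = c * A ^ (-s) / 2 / 2 ^ k * ρ ^ (-((s - (D - treeDim ρ)) * θ) * k) := by
        rw [div_pow, Real.rpow_mul h0.le, Real.rpow_natCast]
        ring
    _ ≤ c * A ^ (-s) / 2 / 2 ^ k * (ρ ^ m) ^ (-(s - (D - treeDim ρ))) := by gcongr
    _ = 2 ^ (m - k) * (c * (ρ ^ m) ^ D) * ((A * ρ ^ m) ^ (-s) / 2) := by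
        rw [show -(s - (D - treeDim ρ)) = -treeDim ρ + D + -s by ring, Real.rpow_add hx,
          Real.rpow_add hx, hcard, Real.mul_rpow hA.le hx.le]
        ring

theorem eventually_two_pow_mul_exp_expected_hits_le (h0 : 0 < ρ) (h1 : ρ < 1) (hs : 0 < s)
    (hc : 0 < c) (hA : 0 < A) (hθ : 0 ≤ θ) (hsθ : treeDim ρ < (s - (D - treeDim ρ)) * θ)
    (hkM : ∀ k, k ≤ M k) (hM : ∀ k, θ * k ≤ M k) (j : ℕ) :
    ∀ᶠ k : ℕ in atTop, 2 ^ k * Real.exp (-(2 ^ (M k - k) * (c * (ρ ^ M k) ^ D) *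
      (⌊(A * ρ ^ M k) ^ (-s)⌋₊ - j : ℕ))) ≤ (1 / 2) ^ k := by
  have hd := treeDim_pos h0 h1
  have hs' : 0 ≤ s - (D - treeDim ρ) := by
    by_contra! h
    nlinarith
  have hγ : 1 < ρ ^ (-((s - (D - treeDim ρ)) * θ)) / 2 := by
    have htwo : ρ ^ (-treeDim ρ) = 2 := by
      rw [Real.rpow_neg h0.le, rpow_treeDim h0 h1]
      norm_num
    rw [lt_div_iff₀ two_pos, one_mul, ← htwo]
    exact Real.rpow_lt_rpow_of_exponent_gt h0 h1 (neg_lt_neg hsθ)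
  have hlim : Tendsto (fun k => (A * ρ ^ M k) ^ (-s)) atTop atTop := by
    have hpow : Tendsto (fun k => A * ρ ^ M k) atTop (𝓝 (A * 0)) :=
      ((tendsto_pow_atTop_nhds_zero_of_lt_one h0.le h1).comp
        (tendsto_atTop_mono hkM tendsto_id)).const_mul A
    rw [mul_zero] at hpow
    exact (tendsto_rpow_neg_nhdsGT_zero (neg_lt_zero.2 hs)).comp (tendsto_nhdsWithin_iff.2
      ⟨hpow, Eventually.of_forall fun k => mul_pos hA (pow_pos h0 _)⟩)
  filter_upwards [eventually_two_pow_mul_exp_le (c := c * A ^ (-s) / 2) (by positivity) hγ,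
    eventually_half_le_floor_sub hlim j] with k hk hfloor
  refine le_trans ?_ hk
  gcongr 2 ^ k * Real.exp (-?_)
  refine (le_expected_hits h0 h1 hs' hc.le hA (hkM k) (hM k)).trans ?_
  gcongr

theorem ae_forall_eventually_exists_hit {X : Type*} [MeasurableSpace X] {μ : Measure X}
    [IsProbabilityMeasure μ] {U : (m : ℕ) → (Fin m → Bool) → Set X} (h0 : 0 < ρ) (h1 : ρ < 1)
    (hs : 0 < s) (hc : 0 < c) (hA : 0 < A) (hθ : 0 ≤ θ)
    (hsθ : treeDim ρ < (s - (D - treeDim ρ)) * θ) (hkM : ∀ k, k ≤ M k)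
    (hM : ∀ k, θ * k ≤ M k) (hUm : ∀ m u, MeasurableSet (U m u))
    (hUd : ∀ m, Pairwise (Function.onFun Disjoint (U m)))
    (hU : ∀ m u, ENNReal.ofReal (c * (ρ ^ m) ^ D) ≤ μ (U m u)) :
    ∀ᵐ ω ∂(Measure.infinitePi fun _ : ℕ => μ), ∀ j, ∀ᶠ k in atTop, ∀ w : Fin k → Bool,
      ∃ u ∈ extensions w (M k), ∃ n ∈ Finset.Ico j ⌊(A * ρ ^ M k) ^ (-s)⌋₊, ω n ∈ U (M k) u := by
  refine ae_all_iff.2 fun j => ?_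
  filter_upwards [ae_eventually_forall_exists_mem
    (V := fun k w => ⋃ u ∈ extensions w (M k), U (M k) u)
    (fun k w => Finset.measurableSet_biUnion _ fun u _ => hUm _ u) (fun k => by positivity)
    (fun k w => ofReal_le_measure_biUnion_extensions (hkM k) w (hUm _) (hUd _) (hU _))
    (eventually_two_pow_mul_exp_expected_hits_le h0 h1 hs hc hA hθ hsθ hkM hM j)] with ω hω
  filter_upwards [hω] with k hk w
  obtain ⟨n, hn, hnU⟩ := hk w
  obtain ⟨u, hu, hnU⟩ := mem_iUnion₂.1 hnU
  exact ⟨u, hu, n, hn, hnU⟩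

end HitCount

section RandomCovering

variable {X : Type*} [MetricSpace X] {ρ D α c A θ t : ℝ} {F : (ℕ → Bool) → X} {M : ℕ → ℕ}
  {U : (m : ℕ) → (Fin m → Bool) → Set X}

theorem le_add_one_rpow_neg_of_lt_floor {r : ℝ} (hr : 0 < r) (hα : 0 < α) {n : ℕ}
    (hn : n < ⌊r ^ (-(1 / α))⌋₊) : r ≤ ((n : ℝ) + 1) ^ (-α) := by
  have hle : (n : ℝ) + 1 ≤ r ^ (-(1 / α)) :=
    le_trans (by exact_mod_cast hn) (Nat.floor_le (by positivity))
  calc r = (r ^ (-(1 / α))) ^ (-α) := by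
        rw [← Real.rpow_mul hr.le, neg_mul_neg, one_div_mul_cancel hα.ne', Real.rpow_one]
    _ ≤ ((n : ℝ) + 1) ^ (-α) :=
        Real.rpow_le_rpow_of_nonpos (by positivity) hle (neg_nonpos.2 hα.le)

variable [MeasurableSpace X] [BorelSpace X]

theorem ofReal_le_dimH_limsupBalls (hF : IsBinaryCoding ρ F) (hα : 0 < α) (hA : 0 < A)
    (hFU : ∀ m (u : ℕ → Bool), ∀ y ∈ U m (fun i => u i), dist (F u) y ≤ A * ρ ^ m)
    (ht : 0 < t) (htd : t ≤ treeDim ρ) (htθ : t / treeDim ρ * θ < 1) (hkM : ∀ k, k ≤ M k)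
    (hM : ∀ k, (M k : ℝ) ≤ θ * k + 1) {ω : ℕ → X}
    (hω : ∀ j, ∀ᶠ k in atTop, ∀ w : Fin k → Bool, ∃ u ∈ extensions w (M k),
      ∃ n ∈ Finset.Ico j ⌊(A * ρ ^ M k) ^ (-(1 / α))⌋₊, ω n ∈ U (M k) u) :
    ENNReal.ofReal t ≤ dimH (limsupBalls α ω) := by
  have hd := treeDim_pos hF.pos hF.lt_one
  let G (j m : ℕ) : Set (ℕ → Bool) :=
    {u | ∃ n ∈ Finset.Ico j ⌊(A * ρ ^ m) ^ (-(1 / α))⌋₊, ω n ∈ U m fun i => u i}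
  have hG (j m : ℕ) : ∀ u ∈ G j m, PiNat.cylinder u m ⊆ G j m := by
    rintro u ⟨n, hn, hnU⟩ v hv
    have hprefix : (fun i : Fin m => v i) = fun i : Fin m => u i := funext fun i => hv i i.isLt
    exact ⟨n, hn, hprefix ▸ hnU⟩
  have hGM (j : ℕ) : ∀ᶠ k in atTop, ∀ w, (PiNat.cylinder w k ∩ G j (M k)).Nonempty := by
    filter_upwards [hω j] with k hk w
    obtain ⟨u, hu, n, hn, hnU⟩ := hk fun i => w i
    refine ⟨extendFalse u, fun i hi => ?_, n, hn, ?_⟩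
    · rw [extendFalse_of_lt u (hi.trans_le (hkM k))]
      exact mem_extensions.1 hu _ hi
    · rwa [funext (extendFalse_coe u)]
  obtain ⟨κ, hκ, hκle, hκG⟩ := exists_measure_ae_forall_exists_mem hG hM hkM
    (div_pos ht hd).le ((div_le_one hd).2 htd) htθ hGM
  refine hF.ofReal_le_dimH κ ht (C := 2) (fun u l => (hκle u l).trans_eq ?_)
    (hκG.mono fun u hu => mem_iInter.2 fun j => ?_)
  · have hpow := pow_pos hF.pos l
    rw [coinMeasure_cylinder_eq_ofReal hF.pos hF.lt_one,
      ENNReal.ofReal_rpow_of_pos (Real.rpow_pos_of_pos hpow _), ← Real.rpow_mul hpow.le,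
      mul_div_cancel₀ t hd.ne', ENNReal.coe_ofNat]
  · obtain ⟨m, n, hn, hnU⟩ := hu j
    rw [Finset.mem_Ico] at hn
    exact mem_iUnion₂.2 ⟨n, hn.1, Metric.mem_closedBall.2 ((hFU m u _ hnU).trans
      (le_add_one_rpow_neg_of_lt_floor (mul_pos hA (pow_pos hF.pos m)) hα hn.2))⟩

variable {μ : Measure X} [IsProbabilityMeasure μ]

theorem ae_le_dimH_limsupBalls (hF : IsBinaryCoding ρ F) (hα : 0 < α) (hc : 0 < c) (hA : 0 < A)
    (hUm : ∀ m u, MeasurableSet (U m u)) (hUd : ∀ m, Pairwise (Function.onFun Disjoint (U m)))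
    (hU : ∀ m u, ENNReal.ofReal (c * (ρ ^ m) ^ D) ≤ μ (U m u))
    (hFU : ∀ m (u : ℕ → Bool), ∀ y ∈ U m (fun i => u i), dist (F u) y ≤ A * ρ ^ m) :
    ∀ᵐ ω ∂(Measure.infinitePi fun _ : ℕ => μ),
      ENNReal.ofReal (min (treeDim ρ) (1 / α - (D - treeDim ρ))) ≤ dimH (limsupBalls α ω) := by
  have hd := treeDim_pos hF.pos hF.lt_one
  refine ae_ofReal_le_of_forall_lt fun t ht htmin => ?_
  obtain ⟨t', htt', ht'⟩ := exists_between htmin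
  have ht'0 : 0 < t' := ht.trans htt'
  obtain ⟨ht'd, ht'α⟩ := lt_min_iff.1 ht'
  have hθ : 1 ≤ treeDim ρ / t' := (one_le_div ht'0).2 ht'd.le
  have hM (k : ℕ) : treeDim ρ / t' * k ≤ ⌈treeDim ρ / t' * k⌉₊ := Nat.le_ceil _
  have hkM (k : ℕ) : k ≤ ⌈treeDim ρ / t' * k⌉₊ :=
    Nat.cast_le.1 ((le_mul_of_one_le_left k.cast_nonneg hθ).trans (hM k))
  have hsθ : treeDim ρ < (1 / α - (D - treeDim ρ)) * (treeDim ρ / t') := by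
    rw [← mul_div_assoc, lt_div_iff₀ ht'0, mul_comm]
    gcongr
  filter_upwards [ae_forall_eventually_exists_hit hF.pos hF.lt_one (one_div_pos.2 hα) hc hA
    (zero_le_one.trans hθ) hsθ hkM hM hUm hUd hU] with ω hω
  exact ofReal_le_dimH_limsupBalls hF hα hA hFU ht (htt'.trans ht'd).le
    (by rwa [div_mul_div_cancel₀ hd.ne', div_lt_one₀ ht'0]) hkM
    (fun k => (Nat.ceil_lt_add_one (by positivity)).le) hω

theorem ae_le_dimH_limsupBalls_of_smul_map_le (hF : IsBinaryCoding ρ F) (hα : 0 < α) (hc : 0 < c)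
    (hμ : ENNReal.ofReal c • coinMeasure.map F ≤ μ) :
    ∀ᵐ ω ∂(Measure.infinitePi fun _ : ℕ => μ),
      ENNReal.ofReal (min (treeDim ρ) (1 / α)) ≤ dimH (limsupBalls α ω) := by
  obtain ⟨A, hA, hAF⟩ := hF.exists_dist_le
  have hmeas (m : ℕ) (u : Fin m → Bool) :
      MeasurableSet (F '' PiNat.cylinder (extendFalse u) m) := by
    rw [PiNat.cylinder_eq_pi]
    exact ((isClosed_set_pi fun _ _ => isClosed_discrete _).isCompact.image
      hF.continuous).isClosed.measurableSet
  have h := ae_le_dimH_limsupBalls (μ := μ) (D := treeDim ρ) (c := c)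
    (U := fun m u => F '' PiNat.cylinder (extendFalse u) m) hF hα hc hA hmeas ?_ ?_ ?_
  · simpa using h
  · refine fun m u v huv => (disjoint_image_iff hF.injective).2 (disjoint_left.2 fun x hu hv =>
      huv (funext fun i => ?_))
    rw [← extendFalse_coe u, ← extendFalse_coe v, ← hu i i.isLt, hv i i.isLt]
  · intro m u
    calc ENNReal.ofReal (c * (ρ ^ m) ^ treeDim ρ)
        = (ENNReal.ofReal c • coinMeasure.map F) (F '' PiNat.cylinder (extendFalse u) m) := by
          rw [Measure.smul_apply, Measure.map_apply hF.measurable (hmeas m u),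
            preimage_image_eq _ hF.injective, coinMeasure_cylinder_eq_ofReal hF.pos hF.lt_one,
            smul_eq_mul, ENNReal.ofReal_mul hc.le]
      _ ≤ μ (F '' PiNat.cylinder (extendFalse u) m) := hμ _
  · rintro m u _ ⟨v, hv, rfl⟩
    rw [dist_comm]
    exact hAF u m v fun i hi => (hv i hi).trans (extendFalse_of_lt _ hi)

end RandomCovering

/-! ### Upper bounds for random limsup sets -/

section UpperBound

variable {X : Type*} [MetricSpace X]

theorem dimH_limsup_le {A : ℕ → Set X} {t : ℝ} (ht : 0 < t)
    (h : ∑' n, Metric.ediam (A n) ^ t ≠ ⊤) :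
    dimH (⋂ k : ℕ, ⋃ n : ℕ, ⋃ _ : k ≤ n, A n) ≤ ENNReal.ofReal t := by
  borelize X
  have htail := ENNReal.tendsto_sum_nat_add _ h
  have hdiam : Tendsto (fun n => (∑' i, Metric.ediam (A (i + n)) ^ t) ^ t⁻¹) atTop (𝓝 0) := by
    simpa [ENNReal.zero_rpow_of_pos (inv_pos.2 ht)] using htail.ennrpow_const t⁻¹
  have hzero : Measure.hausdorffMeasure t (⋂ k : ℕ, ⋃ n : ℕ, ⋃ _ : k ≤ n, A n) ≤ 0 := by
    rw [← htail.liminf_eq]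
    refine Measure.hausdorffMeasure_le_liminf_tsum t _ _ hdiam (fun n i => A (i + n))
      (Eventually.of_forall fun n i => ?_) (Eventually.of_forall fun n x hx => ?_)
    · rw [ENNReal.le_rpow_inv_iff ht]
      exact ENNReal.le_tsum (f := fun i => Metric.ediam (A (i + n)) ^ t) i
    · obtain ⟨m, hnm, hxm⟩ := mem_iUnion₂.1 (mem_iInter.1 hx n)
      exact mem_iUnion.2 ⟨m - n, by rwa [Nat.sub_add_cancel hnm]⟩
  refine dimH_le_of_hausdorffMeasure_ne_top (d := t.toNNReal) ?_
  rw [Real.coe_toNNReal _ ht.le]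
  exact (hzero.trans_lt ENNReal.zero_lt_top).ne

theorem limsupBalls_subset_of_isClosed {α : ℝ} (hα : 0 < α) {S : Set X} (hS : IsClosed S)
    {ω : ℕ → X} (hω : ∀ n, ω n ∈ S) : limsupBalls α ω ⊆ S := by
  intro x hx
  refine hS.closure_subset (Metric.mem_closure_iff.2 fun ε hε => ?_)
  have hlim : Tendsto (fun n : ℕ => ((n : ℝ) + 1) ^ (-α)) atTop (𝓝 0) :=
    (tendsto_rpow_neg_atTop hα).comp (tendsto_natCast_atTop_atTop.atTop_add tendsto_const_nhds)
  obtain ⟨K, hK⟩ := eventually_atTop.1 (hlim.eventually_lt_const hε)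
  obtain ⟨n, hKn, hxn⟩ := mem_iUnion₂.1 (mem_iInter.1 hx K)
  exact ⟨ω n, hω n, (Metric.mem_closedBall.1 hxn).trans_lt (hK n hKn)⟩

theorem dimH_limsupBalls_inter_le {α t : ℝ} (ht : 0 < t) (C : Set X) {ω : ℕ → X}
    (h : ∑' n : ℕ, (Metric.cthickening (((n : ℝ) + 1) ^ (-α)) C).indicator
      (fun _ => ENNReal.ofReal ((2 * ((n : ℝ) + 1) ^ (-α)) ^ t)) (ω n) ≠ ⊤) :
    dimH (limsupBalls α ω ∩ C) ≤ ENNReal.ofReal t := by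
  let A (n : ℕ) : Set X := {x ∈ Metric.closedBall (ω n) (((n : ℝ) + 1) ^ (-α)) |
    ω n ∈ Metric.cthickening (((n : ℝ) + 1) ^ (-α)) C}
  have hsub : limsupBalls α ω ∩ C ⊆ ⋂ k : ℕ, ⋃ n : ℕ, ⋃ _ : k ≤ n, A n := by
    rintro x ⟨hx, hxC⟩
    refine mem_iInter.2 fun k => ?_
    obtain ⟨n, hkn, hxn⟩ := mem_iUnion₂.1 (mem_iInter.1 hx k)
    exact mem_iUnion₂.2 ⟨n, hkn, hxn,
      Metric.mem_cthickening_of_dist_le _ x _ _ hxC (Metric.mem_closedBall'.1 hxn)⟩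
  refine (dimH_mono hsub).trans
    (dimH_limsup_le ht (ne_top_of_le_ne_top h (ENNReal.tsum_le_tsum fun n => ?_)))
  by_cases hn : ω n ∈ Metric.cthickening (((n : ℝ) + 1) ^ (-α)) C
  · rw [indicator_of_mem hn, ← ENNReal.ofReal_rpow_of_nonneg (by positivity) ht.le]
    gcongr
    refine Metric.ediam_le_of_forall_dist_le fun x hx y hy => ?_
    linarith [dist_triangle_right x y (ω n), Metric.mem_closedBall.1 hx.1,
      Metric.mem_closedBall.1 hy.1]
  · rw [show A n = ∅ from eq_empty_of_forall_notMem fun x hx => hn hx.2, Metric.ediam_empty,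
      ENNReal.zero_rpow_of_pos ht]
    exact zero_le

variable [MeasurableSpace X] {μ : Measure X} {α γ K : ℝ} {C : Set X}

theorem tsum_ofReal_mul_measure_cthickening_ne_top {t : ℝ} (hα : 0 < α) (hαt : 1 / α - γ < t)
    (hμ : ∀ r : ℝ, 0 < r → r ≤ 1 → μ (Metric.cthickening r C) ≤ ENNReal.ofReal (K * r ^ γ)) :
    ∑' n : ℕ, ENNReal.ofReal ((2 * ((n : ℝ) + 1) ^ (-α)) ^ t) *
      μ (Metric.cthickening (((n : ℝ) + 1) ^ (-α)) C) ≠ ⊤ := by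
  have hterm (n : ℕ) : ENNReal.ofReal ((2 * ((n : ℝ) + 1) ^ (-α)) ^ t) *
      μ (Metric.cthickening (((n : ℝ) + 1) ^ (-α)) C) ≤
        ENNReal.ofReal (K * 2 ^ t * (1 / |(n : ℝ) + 1| ^ (α * (t + γ)))) := by
    have hn : (0 : ℝ) < (n : ℝ) + 1 := by positivity
    have hr : ((n : ℝ) + 1) ^ (-α) ≤ 1 :=
      Real.rpow_le_one_of_one_le_of_nonpos (by linarith [n.cast_nonneg (α := ℝ)]) (by linarith)
    refine (mul_le_mul_right (hμ _ (by positivity) hr) _).trans_eq ?_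
    rw [← ENNReal.ofReal_mul (by positivity), Real.mul_rpow zero_le_two (by positivity),
      abs_of_pos hn, one_div, ← Real.rpow_neg hn.le, ← Real.rpow_mul hn.le,
      ← Real.rpow_mul hn.le, show -(α * (t + γ)) = -α * t + -α * γ by ring, Real.rpow_add hn]
    ring_nf
  have hexp : 1 < α * (t + γ) := by
    rw [mul_comm, ← div_lt_iff₀ hα]
    linarith
  exact ne_top_of_le_ne_top (((Real.summable_one_div_nat_add_rpow 1 _).2 hexp).mul_left
    (K * 2 ^ t)).tsum_ofReal_ne_top (ENNReal.tsum_le_tsum hterm)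

theorem ae_dimH_limsupBalls_inter_le [BorelSpace X] [IsProbabilityMeasure μ] (hα : 0 < α)
    (hμ : ∀ r : ℝ, 0 < r → r ≤ 1 → μ (Metric.cthickening r C) ≤ ENNReal.ofReal (K * r ^ γ)) :
    ∀ᵐ ω ∂(Measure.infinitePi fun _ : ℕ => μ),
      dimH (limsupBalls α ω ∩ C) ≤ ENNReal.ofReal (1 / α - γ) := by
  refine ae_le_ofReal_of_forall_gt fun t ht hαt => ?_
  let r (n : ℕ) : ℝ := ((n : ℝ) + 1) ^ (-α)
  let mass (n : ℕ) : X → ℝ≥0∞ :=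
    (Metric.cthickening (r n) C).indicator fun _ => ENNReal.ofReal ((2 * r n) ^ t)
  have hmass (n : ℕ) : Measurable (mass n) :=
    measurable_const.indicator Metric.isClosed_cthickening.measurableSet
  have hmass' (n : ℕ) : Measurable fun ω : ℕ → X => mass n (ω n) :=
    (hmass n).comp (measurable_pi_apply n)
  have hexpect (n : ℕ) : ∫⁻ ω, mass n (ω n) ∂(Measure.infinitePi fun _ : ℕ => μ) =
      ENNReal.ofReal ((2 * r n) ^ t) * μ (Metric.cthickening (r n) C) := by
    rw [(measurePreserving_eval_infinitePi (fun _ : ℕ => μ) n).lintegral_comp (hmass n),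
      lintegral_indicator_const Metric.isClosed_cthickening.measurableSet]
  have hfinite : ∫⁻ ω, ∑' n, mass n (ω n) ∂(Measure.infinitePi fun _ : ℕ => μ) ≠ ⊤ := by
    rw [lintegral_tsum fun n => (hmass' n).aemeasurable, tsum_congr hexpect]
    exact tsum_ofReal_mul_measure_cthickening_ne_top hα hαt hμ
  filter_upwards [ae_lt_top (Measurable.tsum hmass') hfinite] with ω hω
  exact dimH_limsupBalls_inter_le ht C hω.ne

end UpperBound

/-! ### Local dimensions -/

section LocalDimension

theorem le_of_eventually_ofReal_mul_rpow_le {c C s t : ℝ} (hc : 0 < c)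
    (h : ∀ᶠ r in 𝓝[>] (0 : ℝ), ENNReal.ofReal (c * r ^ s) ≤ ENNReal.ofReal (C * r ^ t)) :
    t ≤ s := by
  by_contra! hlt
  have hlim : Tendsto (fun r : ℝ => C * r ^ (t - s)) (𝓝[>] 0) (𝓝 0) := by
    have hcont := (Real.continuousAt_rpow_const 0 (t - s) (Or.inr (sub_pos.2 hlt).le)).tendsto
    simpa [Real.zero_rpow (sub_pos.2 hlt).ne'] using
      (hcont.mono_left (nhdsWithin_le_nhds (s := Ioi (0 : ℝ)))).const_mul C
  refine hc.not_ge (ge_of_tendsto hlim ?_)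
  filter_upwards [h, self_mem_nhdsWithin] with r hr hr0
  have hrs := Real.rpow_pos_of_pos hr0 s
  rcases ENNReal.ofReal_le_ofReal_iff'.1 hr with hr | hr
  · rw [← sub_add_cancel t s, Real.rpow_add hr0, ← mul_assoc] at hr
    exact le_of_mul_le_mul_right hr hrs
  · exact absurd hr (mul_pos hc hrs).not_ge

variable {X : Type*} [PseudoMetricSpace X] [MeasurableSpace X] {μ : Measure X} {x : X} {D c C : ℝ}

theorem lowerLocalDim_le (hc : 0 < c)
    (h : ∀ᶠ r in 𝓝[>] (0 : ℝ), ENNReal.ofReal (c * r ^ D) ≤ μ (Metric.ball x r)) :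
    lowerLocalDim μ x ≤ D := by
  refine sSup_le ?_
  rintro _ ⟨s, ⟨C, hC⟩, rfl⟩
  refine EReal.coe_le_coe (le_of_eventually_ofReal_mul_rpow_le (C := C) hc ?_)
  filter_upwards [h, self_mem_nhdsWithin] with r hr hr0
  exact hr.trans (hC r hr0)

theorem upperLocalDim_le (hc : 0 < c)
    (h : ∀ r : ℝ, 0 < r → r ≤ 1 → ENNReal.ofReal (c * r ^ D) ≤ μ (Metric.ball x r)) :
    upperLocalDim μ x ≤ D :=
  sInf_le ⟨D, ⟨c, hc, h⟩, rfl⟩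

theorem le_lowerLocalDim [IsFiniteMeasure μ] (hD : 0 ≤ D)
    (h : ∀ᶠ r in 𝓝[>] (0 : ℝ), μ (Metric.ball x r) ≤ ENNReal.ofReal (C * r ^ D)) :
    D ≤ lowerLocalDim μ x := by
  obtain ⟨r₀, hr₀, hsmall⟩ := mem_nhdsGT_iff_exists_Ioc_subset.1 h
  rw [mem_Ioi] at hr₀
  refine le_sSup ⟨D, ⟨max C (μ.real univ * r₀ ^ (-D)), fun r hr => ?_⟩, rfl⟩
  rcases le_or_gt r r₀ with hle | hlt
  · refine (hsmall ⟨hr, hle⟩).trans (ENNReal.ofReal_le_ofReal ?_)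
    gcongr
    exact le_max_left _ _
  · rw [← ofReal_measureReal (measure_ne_top μ _)]
    refine ENNReal.ofReal_le_ofReal ?_
    calc μ.real (Metric.ball x r) ≤ μ.real univ := measureReal_mono (subset_univ _)
      _ = μ.real univ * r₀ ^ (-D) * r₀ ^ D := by
        rw [mul_assoc, ← Real.rpow_add hr₀, neg_add_cancel, Real.rpow_zero, mul_one]
      _ ≤ max C (μ.real univ * r₀ ^ (-D)) * r ^ D := by
        gcongr
        exact le_max_right _ _

theorem le_upperLocalDim
    (h : ∀ᶠ r in 𝓝[>] (0 : ℝ), μ (Metric.ball x r) ≤ ENNReal.ofReal (C * r ^ D)) :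
    D ≤ upperLocalDim μ x := by
  refine le_sInf ?_
  rintro _ ⟨s, ⟨c, hc, hcs⟩, rfl⟩
  refine EReal.coe_le_coe (le_of_eventually_ofReal_mul_rpow_le (C := C) hc ?_)
  filter_upwards [h, Ioc_mem_nhdsGT one_pos] with r hr hr1
  exact (hcs r hr1.1 hr1.2).trans hr

theorem lowerLocalDim_eq_and_upperLocalDim_eq [IsFiniteMeasure μ] (hD : 0 ≤ D) (hc : 0 < c)
    (hlow : ∀ r : ℝ, 0 < r → r ≤ 1 → ENNReal.ofReal (c * r ^ D) ≤ μ (Metric.ball x r))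
    (hup : ∀ᶠ r in 𝓝[>] (0 : ℝ), μ (Metric.ball x r) ≤ ENNReal.ofReal (C * r ^ D)) :
    lowerLocalDim μ x = D ∧ upperLocalDim μ x = D := by
  refine ⟨(lowerLocalDim_le hc ?_).antisymm (le_lowerLocalDim hD hup),
    (upperLocalDim_le hc hlow).antisymm (le_upperLocalDim hup)⟩
  filter_upwards [Ioc_mem_nhdsGT one_pos] with r hr
  exact hlow r hr.1 hr.2

theorem eventually_measure_ball_eq_zero (hx : x ∉ μ.support) :
    ∀ᶠ r in 𝓝[>] (0 : ℝ), μ (Metric.ball x r) = 0 := by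
  obtain ⟨r₀, hr₀, hzero⟩ := Metric.nhds_basis_ball.notMem_measureSupport.1 hx
  filter_upwards [Ioc_mem_nhdsGT hr₀] with r hr
  exact measure_mono_null (Metric.ball_subset_ball hr.2) hzero

theorem lowerLocalDim_eq_top_and_upperLocalDim_eq_top [IsFiniteMeasure μ] (hx : x ∉ μ.support) :
    lowerLocalDim μ x = ⊤ ∧ upperLocalDim μ x = ⊤ := by
  have hsmall (D : ℝ) :
      ∀ᶠ r in 𝓝[>] (0 : ℝ), μ (Metric.ball x r) ≤ ENNReal.ofReal (0 * r ^ D) :=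
    (eventually_measure_ball_eq_zero hx).mono fun r hr => hr.trans_le zero_le
  refine ⟨(EReal.eq_top_iff_forall_lt _).2 fun D => ?_,
    (EReal.eq_top_iff_forall_lt _).2 fun D => ?_⟩
  · exact (EReal.coe_lt_coe ((lt_add_one D).trans_le (le_max_left _ 0))).trans_le
      (le_lowerLocalDim (le_max_right _ _) (hsmall _))
  · exact (EReal.coe_lt_coe (lt_add_one D)).trans_le (le_upperLocalDim (hsmall _))

end LocalDimension

/-! ### The increasing 1-Lipschitz hull -/

section Hull

variable {g h : ℝ → ℝ} {s₀ s₁ d₁ : ℝ}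

theorem increasingLipschitzHull_le (hmono : Monotone h) (hlip : LipschitzWith 1 h)
    (hle : ∀ z, g z ≤ h z) (s : ℝ) : increasingLipschitzHull g s ≤ h s := by
  refine csInf_le ⟨g s, ?_⟩ ⟨h, hmono, hlip, hle, rfl⟩
  rintro _ ⟨h', -, -, hle', rfl⟩
  exact hle' s

theorem sub_le_increasingLipschitzHull (hg : BddAbove (range g)) (s t : ℝ) :
    g t - max (t - s) 0 ≤ increasingLipschitzHull g s := by
  obtain ⟨B, hB⟩ := hg
  refine le_csInf ⟨B, fun _ => B, monotone_const, LipschitzWith.const' B,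
    fun z => hB (mem_range_self z), rfl⟩ ?_
  rintro _ ⟨h, hmono, hlip, hle, rfl⟩
  rcases le_total t s with hts | hst
  · linarith [hle t, hmono hts, le_max_right (t - s) 0]
  · have hdist := hlip.dist_le_mul t s
    rw [NNReal.coe_one, one_mul, Real.dist_eq, Real.dist_eq, abs_of_nonneg (sub_nonneg.2 hst)]
      at hdist
    linarith [hle t, le_abs_self (h t - h s), le_max_left (t - s) 0]

theorem sub_max_sub_zero (x s t : ℝ) : x - max (t - s) 0 = min s t - (t - x) := by
  rcases le_total t s with hts | hst
  · rw [max_eq_right (sub_nonpos.2 hts), min_eq_right hts]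
    ring
  · rw [max_eq_left (sub_nonneg.2 hst), min_eq_left hst]
    ring

theorem increasingLipschitzHull_step (h0 : 0 ≤ s₀) (h1 : s₀ ≤ d₁) (h2 : s₀ < s₁)
    {s : ℝ} (hs : 0 ≤ s) :
    increasingLipschitzHull (fun z => if z < s₀ then 0 else if z < s₁ then s₀ else d₁) s =
      max (min s s₀) (min s s₁ - (s₁ - d₁)) := by
  refine le_antisymm ?_ (max_le ?_ ?_)
  · have hlip : LipschitzWith 1
        fun x : ℝ => max 0 (max (min x s₀) (min x s₁ - (s₁ - d₁))) := by
      simpa [sub_eq_add_neg] using ((LipschitzWith.id.min_const s₀).max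
        ((LipschitzWith.id.min_const s₁).add (LipschitzWith.const (-(s₁ - d₁))))).const_max 0
    have hmono : Monotone fun x : ℝ => max 0 (max (min x s₀) (min x s₁ - (s₁ - d₁))) := by
      intro x y hxy
      dsimp only
      gcongr
    refine (increasingLipschitzHull_le hmono hlip (fun z => ?_) s).trans_eq
      (max_eq_right (le_max_of_le_left (le_min hs h0)))
    split_ifs with hz hz'
    · exact le_max_left _ _
    · exact le_max_of_le_right (le_max_of_le_left (min_eq_right (not_lt.1 hz)).ge)
    · refine le_max_of_le_right (le_max_of_le_right ?_)
      rw [min_eq_right (not_lt.1 hz'), sub_sub_cancel]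
  all_goals
    have hbdd : BddAbove (range fun z => if z < s₀ then 0 else if z < s₁ then s₀ else d₁) :=
      ⟨d₁, by rintro _ ⟨z, rfl⟩; dsimp only; split_ifs <;> linarith⟩
  · simpa [sub_max_sub_zero, h2] using sub_le_increasingLipschitzHull hbdd s s₀
  · simpa [sub_max_sub_zero, h2.not_gt] using sub_le_increasingLipschitzHull hbdd s s₁

theorem not_concaveOn_of_eq_max_min (h0 : 0 < s₀) (h1 : s₀ < d₁) (h2 : d₁ < s₁) {f : ℝ → ℝ}
    (hf : ∀ s, 0 ≤ s → f s = max (min s s₀) (min s s₁ - (s₁ - d₁))) :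
    ¬ ConcaveOn ℝ (Ioi (0 : ℝ)) f := by
  intro hconcave
  have hf₀ : f s₀ = s₀ := by
    rw [hf _ h0.le, min_self, min_eq_left (by linarith), max_eq_left (by linarith)]
  have hflat : f (s₀ + (s₁ - d₁)) = s₀ := by
    rw [hf _ (by linarith), min_eq_right (by linarith), min_eq_left (by linarith),
      add_sub_cancel_right, max_self]
  have hf₁ : f s₁ = d₁ := by
    rw [hf _ (by linarith), min_eq_right (by linarith), min_self, sub_sub_cancel,
      max_eq_right h1.le]
  have hslope := hconcave.slope_anti_adjacent h0 (mem_Ioi.2 (by linarith : 0 < s₁))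
    (show s₀ < s₀ + (s₁ - d₁) by linarith) (show s₀ + (s₁ - d₁) < s₁ by linarith)
  rw [hf₀, hflat, hf₁, sub_self, zero_div] at hslope
  exact hslope.not_gt (div_pos (by linarith) (by linarith))

end Hull

/-! ### The gap measure -/

theorem one_sub_mul_tsum_ite_le_pow {q : ℝ≥0∞} (hq : q < 1) (l : ℕ) :
    (1 - q) * ∑' j : ℕ, (if l ≤ j then q ^ j else 0) = q ^ l := by
  have hhead : ∑ j ∈ Finset.range l, (if l ≤ j then q ^ j else 0) = 0 :=
    Finset.sum_eq_zero fun j hj => if_neg (Finset.mem_range.1 hj).not_ge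
  have htail (j : ℕ) : (if l ≤ j + l then q ^ (j + l) else 0) = q ^ j * q ^ l := by
    rw [if_pos (Nat.le_add_left l j), pow_add]
  rw [← ENNReal.summable.sum_add_tsum_nat_add' (k := l), hhead, zero_add, tsum_congr htail,
    ENNReal.tsum_mul_right, ENNReal.tsum_geometric, ← mul_assoc,
    ENNReal.mul_inv_cancel (tsub_pos_of_lt hq).ne' (by finiteness), one_mul]

theorem two_rpow_one_sub_lt_one {β : ℝ} (hβ : 1 < β) : (2 : ℝ) ^ (1 - β) < 1 :=
  Real.rpow_lt_one_of_one_lt_of_neg one_lt_two (sub_neg.2 hβ)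

theorem one_sub_two_rpow_mul_tsum_ite_le {β : ℝ} (hβ : 1 < β) (l : ℕ) :
    ENNReal.ofReal (1 - 2 ^ (1 - β)) * ∑' j : ℕ, ENNReal.ofReal (2 ^ (-β * j)) *
      (if l ≤ j then 2 ^ j else 0) = ENNReal.ofReal (2 ^ ((1 - β) * l)) := by
  have hq : ENNReal.ofReal (2 ^ (1 - β)) < 1 :=
    ENNReal.ofReal_lt_one.2 (two_rpow_one_sub_lt_one hβ)
  have hterm (j : ℕ) : ENNReal.ofReal (2 ^ (-β * j)) * (if l ≤ j then 2 ^ j else 0) =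
      if l ≤ j then ENNReal.ofReal (2 ^ (1 - β)) ^ j else 0 := by
    split_ifs
    · rw [← ENNReal.ofReal_pow (by positivity), ← Real.rpow_mul_natCast zero_le_two,
        ← ENNReal.ofReal_ofNat, ← ENNReal.ofReal_pow zero_le_two,
        ← ENNReal.ofReal_mul (by positivity), ← Real.rpow_natCast 2 j, ← Real.rpow_add two_pos]
      ring_nf
    · exact mul_zero _
  rw [tsum_congr hterm, ENNReal.ofReal_sub _ (by positivity), ENNReal.ofReal_one,
    one_sub_mul_tsum_ite_le_pow hq, ← ENNReal.ofReal_pow (by positivity),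
    ← Real.rpow_mul_natCast zero_le_two]

theorem pow_rpow_mul_treeDim {ρ : ℝ} (h0 : 0 < ρ) (h1 : ρ < 1) (t : ℝ) (l : ℕ) :
    (ρ ^ l) ^ (t * treeDim ρ) = 2 ^ (-t * l) := by
  rw [mul_comm, Real.rpow_mul (by positivity), pow_rpow_treeDim h0 h1, one_div, inv_pow,
    Real.inv_rpow (by positivity), ← Real.rpow_natCast, ← Real.rpow_mul zero_le_two,
    ← Real.rpow_neg zero_le_two]
  ring_nf

/-- The affine map of the interval with address `w`, applied to the coding of the support of the
Bernoulli convolution. The image of the fair coin measure is a summand of `levelMeasure`. -/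
noncomputable def gapMap (lam : ℝ) (a b : (k : ℕ) → (Fin k → Bool) → ℝ) (k : ℕ) (w : Fin k → Bool)
    (u : ℕ → Bool) : ℝ :=
  a k w * signSeries lam u + b k w

/-- The affine maps `x ↦ a k w * x + b k w` are not constant and map the support of the Bernoulli
convolution, which is the range of `signSeries lam`, into the middle ninths. The bound on `lam`
makes this support a Cantor set. -/
structure IsMiddleNinthFamily (lam : ℝ) (a b : (k : ℕ) → (Fin k → Bool) → ℝ) : Prop where
  lam_pos : 0 < lam
  lam_lt : lam < 1 / 2
  ne_zero : ∀ k w, a k w ≠ 0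
  mem_middleNinth : ∀ k w u, gapMap lam a b k w u ∈ middleNinth w

theorem measurableSet_middleNinth {k : ℕ} (w : Fin k → Bool) : MeasurableSet (middleNinth w) :=
  measurableSet_Icc

theorem support_bernoulliConvolution {lam : ℝ} (h0 : 0 < lam) (h1 : lam < 1 / 2) :
    (bernoulliConvolution lam).support = range (signSeries lam) :=
  (isBinaryCoding_signSeries h0 h1).support_coinMeasure_map

section GapMeasure

variable {lam β : ℝ} {a b : (k : ℕ) → (Fin k → Bool) → ℝ}

theorem gapMeasure_apply {S : Set ℝ} (hS : MeasurableSet S) :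
    gapMeasure lam β a b S = ENNReal.ofReal (1 - 2 ^ (1 - β)) *
      ∑' k : ℕ, ENNReal.ofReal (2 ^ (-β * k)) * levelMeasure lam a b k S := by
  simp only [gapMeasure, Measure.smul_apply, Measure.sum_apply _ hS, smul_eq_mul]

theorem gapMeasure_le_of_levelMeasure_le (hβ : 1 < β) {S : Set ℝ} (hS : MeasurableSet S) {l : ℕ}
    {C : ℝ≥0∞} (hC : ∀ j, levelMeasure lam a b j S ≤ C * if l ≤ j then 2 ^ j else 0) :
    gapMeasure lam β a b S ≤ C * ENNReal.ofReal (2 ^ ((1 - β) * l)) := by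
  rw [gapMeasure_apply hS, ← one_sub_two_rpow_mul_tsum_ite_le hβ, mul_left_comm,
    ← ENNReal.tsum_mul_left (a := C)]
  refine mul_le_mul_right (ENNReal.tsum_le_tsum fun j => ?_) _
  rw [mul_left_comm]
  exact mul_le_mul_right (hC j) _

theorem gapMeasure_le_sum_levelMeasure (hβ : 1 < β) {S : Set ℝ} (hS : MeasurableSet S) {J : ℕ}
    (hJ : ∀ j, J ≤ j → levelMeasure lam a b j S = 0) :
    gapMeasure lam β a b S ≤ ∑ j ∈ Finset.range J, levelMeasure lam a b j S := by
  have htail (j : ℕ) (hj : j ∉ Finset.range J) :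
      ENNReal.ofReal (2 ^ (-β * j)) * levelMeasure lam a b j S = 0 := by
    rw [hJ j (not_lt.1 (mt Finset.mem_range.2 hj)), mul_zero]
  rw [gapMeasure_apply hS, tsum_eq_sum htail]
  refine (mul_le_of_le_one_left' (ENNReal.ofReal_le_one.2 ?_)).trans <|
    Finset.sum_le_sum fun j _ => mul_le_of_le_one_left' (ENNReal.ofReal_le_one.2 ?_)
  · exact sub_le_self _ (by positivity)
  · exact Real.rpow_le_one_of_one_le_of_nonpos one_le_two (by nlinarith [j.cast_nonneg (α := ℝ)])

theorem smul_levelMeasure_le_gapMeasure (hβ : 1 < β) (k : ℕ) :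
    ENNReal.ofReal ((1 - 2 ^ (1 - β)) * 2 ^ (-β * k)) • levelMeasure lam a b k ≤
      gapMeasure lam β a b := by
  rw [ENNReal.ofReal_mul (sub_pos.2 (two_rpow_one_sub_lt_one hβ)).le, mul_smul]
  exact fun S => mul_le_mul_right
    (Measure.le_sum (fun k : ℕ => ENNReal.ofReal (2 ^ (-β * k)) • levelMeasure lam a b k) k S) _

namespace IsMiddleNinthFamily

theorem isBinaryCoding (h : IsMiddleNinthFamily lam a b) (k : ℕ) (w : Fin k → Bool) :
    IsBinaryCoding lam (gapMap lam a b k w) :=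
  (isBinaryCoding_signSeries h.lam_pos h.lam_lt).affine (h.ne_zero k w) (b k w)

theorem isProbabilityMeasure_map (h : IsMiddleNinthFamily lam a b) (k : ℕ) (w : Fin k → Bool) :
    IsProbabilityMeasure (coinMeasure.map (gapMap lam a b k w)) :=
  Measure.isProbabilityMeasure_map (h.isBinaryCoding k w).measurable.aemeasurable

theorem levelMeasure_eq (h : IsMiddleNinthFamily lam a b) (k : ℕ) :
    levelMeasure lam a b k = ∑ w : Fin k → Bool, coinMeasure.map (gapMap lam a b k w) :=
  Finset.sum_congr rfl fun w _ => Measure.map_map (by fun_prop)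
    (isBinaryCoding_signSeries h.lam_pos h.lam_lt).measurable

theorem levelMeasure_apply (h : IsMiddleNinthFamily lam a b) (k : ℕ) (S : Set ℝ) :
    levelMeasure lam a b k S = ∑ w : Fin k → Bool, coinMeasure.map (gapMap lam a b k w) S := by
  rw [h.levelMeasure_eq, Measure.finsetSum_apply]

theorem map_le_levelMeasure (h : IsMiddleNinthFamily lam a b) (k : ℕ) (w : Fin k → Bool) :
    coinMeasure.map (gapMap lam a b k w) ≤ levelMeasure lam a b k := by
  refine Measure.le_iff.2 fun S _ => ?_
  rw [h.levelMeasure_apply]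
  exact Finset.single_le_sum (f := fun w => coinMeasure.map (gapMap lam a b k w) S)
    (fun _ _ => zero_le) (Finset.mem_univ w)

theorem smul_map_le_gapMeasure (h : IsMiddleNinthFamily lam a b) (hβ : 1 < β) (k : ℕ)
    (w : Fin k → Bool) :
    ENNReal.ofReal ((1 - 2 ^ (1 - β)) * 2 ^ (-β * k)) • coinMeasure.map (gapMap lam a b k w) ≤
      gapMeasure lam β a b :=
  fun S => (mul_le_mul_right (h.map_le_levelMeasure k w S) _).trans
    (smul_levelMeasure_le_gapMeasure hβ k S)

theorem isProbabilityMeasure_gapMeasure (h : IsMiddleNinthFamily lam a b) (hβ : 1 < β) :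
    IsProbabilityMeasure (gapMeasure lam β a b) := by
  have := h.isProbabilityMeasure_map
  have hsum := one_sub_two_rpow_mul_tsum_ite_le hβ 0
  simp only [zero_le, if_true, Nat.cast_zero, mul_zero, Real.rpow_zero, ENNReal.ofReal_one] at hsum
  refine ⟨?_⟩
  rw [gapMeasure_apply .univ, ← hsum]
  congr! with k
  simp [h.levelMeasure_apply]

theorem support_levelMeasure (h : IsMiddleNinthFamily lam a b) (k : ℕ) :
    (levelMeasure lam a b k).support = ⋃ w : Fin k → Bool, range (gapMap lam a b k w) := by
  have hclosed : IsClosed (⋃ w : Fin k → Bool, range (gapMap lam a b k w)) :=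
    isClosed_iUnion_of_finite fun w => (isCompact_range (h.isBinaryCoding k w).continuous).isClosed
  refine (Measure.support_subset_of_isClosed hclosed ?_).antisymm (iUnion_subset fun w => ?_)
  · rw [mem_ae_iff, h.levelMeasure_apply]
    refine Finset.sum_eq_zero fun w _ => ?_
    rw [← mem_ae_iff, mem_ae_map_iff (h.isBinaryCoding k w).measurable.aemeasurable
      hclosed.measurableSet]
    exact univ_mem' fun u => mem_iUnion.2 ⟨w, mem_range_self u⟩
  · rw [← (h.isBinaryCoding k w).support_coinMeasure_map]
    exact Measure.support_mono (h.map_le_levelMeasure k w)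

theorem ofReal_le_gapMeasure_middleNinth (h : IsMiddleNinthFamily lam a b) (hβ : 1 < β) {k : ℕ}
    (w : Fin k → Bool) :
    ENNReal.ofReal ((1 - 2 ^ (1 - β)) * ((1 / 3) ^ k) ^ (β * treeDim (1 / 3))) ≤
      gapMeasure lam β a b (middleNinth w) := by
  refine le_of_eq_of_le ?_ (h.smul_map_le_gapMeasure hβ k w (middleNinth w))
  have hpre : gapMap lam a b k w ⁻¹' middleNinth w = univ :=
    eq_univ_of_forall (h.mem_middleNinth k w)
  rw [pow_rpow_mul_treeDim (by norm_num) (by norm_num), Measure.smul_apply,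
    Measure.map_apply (h.isBinaryCoding k w).measurable (measurableSet_middleNinth w), hpre,
    measure_univ, smul_eq_mul, mul_one]

theorem levelMeasure_le_card (h : IsMiddleNinthFamily lam a b) {S : Set ℝ} (hS : MeasurableSet S)
    {k : ℕ} {T : Finset (Fin k → Bool)} (hT : ∀ w ∉ T, Disjoint (middleNinth w) S) :
    levelMeasure lam a b k S ≤ T.card := by
  have := h.isProbabilityMeasure_map
  rw [h.levelMeasure_apply]
  calc ∑ w : Fin k → Bool, coinMeasure.map (gapMap lam a b k w) S
      = ∑ w ∈ T, coinMeasure.map (gapMap lam a b k w) S := by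
        refine (Finset.sum_subset (Finset.subset_univ _) fun w _ hw => ?_).symm
        have hpre : gapMap lam a b k w ⁻¹' S = ∅ := eq_empty_of_forall_notMem fun u hu =>
          Set.disjoint_left.1 (hT w hw) (h.mem_middleNinth k w u) hu
        rw [Measure.map_apply (h.isBinaryCoding k w).measurable hS, hpre, measure_empty]
    _ ≤ ∑ w ∈ T, 1 := Finset.sum_le_sum fun w _ => prob_le_one
    _ = T.card := by simp

theorem levelMeasure_eq_zero (h : IsMiddleNinthFamily lam a b) {S : Set ℝ} (hS : MeasurableSet S)
    {k : ℕ} (hd : ∀ w : Fin k → Bool, Disjoint (middleNinth w) S) :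
    levelMeasure lam a b k S = 0 := by
  simpa using h.levelMeasure_le_card hS (T := ∅) fun w _ => hd w

end IsMiddleNinthFamily

end GapMeasure

theorem exists_le_third_pow_le {x : ℝ} (hx : 0 < x) (hx1 : x ≤ 1) :
    ∃ l : ℕ, x ≤ (1 / 3) ^ l ∧ (1 / 3) ^ l ≤ 3 * x := by
  obtain ⟨l, hlt, hle⟩ := exists_nat_pow_near_of_lt_one hx hx1
    (by norm_num : (0 : ℝ) < 1 / 3) (by norm_num)
  exact ⟨l, hle, by rw [pow_succ] at hlt; linarith⟩

theorem disjoint_middleNinth_cthickening_cantorSet {k : ℕ} (w : Fin k → Bool) {r : ℝ}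
    (hr : 0 ≤ r) (hrk : 9 * r < (1 / 3) ^ k) :
    Disjoint (middleNinth w) (Metric.cthickening r cantorSet) := by
  rw [isCompact_cantorSet.cthickening_eq_biUnion_closedBall hr]
  refine Set.disjoint_left.2 fun y hy hyr => ?_
  obtain ⟨x, hx, hyx⟩ := mem_iUnion₂.1 hyr
  rw [Metric.mem_closedBall, dist_comm, Real.dist_eq] at hyx
  linarith [le_abs_sub_of_mem_middleNinth hy hx]

theorem disjoint_middleNinth_ball_cantorPoint {k : ℕ} (w : Fin k → Bool) (u : ℕ → Bool) {r : ℝ}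
    (hr : 0 ≤ r) (hrk : 9 * r < (1 / 3) ^ k) :
    Disjoint (middleNinth w) (Metric.ball (cantorPoint u) r) :=
  (disjoint_middleNinth_cthickening_cantorSet w hr hrk).mono_right fun _ hy =>
    Metric.mem_cthickening_of_dist_le _ _ _ _ (cantorPoint_mem u) (Metric.mem_ball.1 hy).le

theorem notMem_cantorSet_of_mem_middleNinth {k : ℕ} {w : Fin k → Bool} {x : ℝ}
    (hx : x ∈ middleNinth w) : x ∉ cantorSet := by
  intro hxC
  have hdist := le_abs_sub_of_mem_middleNinth hx hxC
  rw [sub_self, abs_zero] at hdist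
  exact hdist.not_gt (by positivity)

theorem mem_extensions_of_mem_middleNinth {l j : ℕ} {w : Fin j → Bool} {u : ℕ → Bool} {y : ℝ}
    (hy : y ∈ middleNinth w) (hyu : |y - cantorPoint u| + (1 / 3) ^ j < (1 / 3) ^ l) :
    w ∈ extensions (fun i : Fin l => u i) j := by
  have hdist : |cantorPoint (extendFalse w) - cantorPoint u| < (1 / 3) ^ l := by
    rw [cantorPoint_extendFalse]
    linarith [abs_sub_le (cantorLeft w) y (cantorPoint u), abs_cantorLeft_sub_le hy]
  refine mem_extensions.2 fun i hi => ?_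
  rw [← extendFalse_coe w i]
  exact mem_cylinder_of_abs_cantorPoint_sub_lt hdist i hi

namespace IsMiddleNinthFamily

variable {lam β : ℝ} {a b : (k : ℕ) → (Fin k → Bool) → ℝ}

-- If a middle ninth of level `j` meets the ball then `3 ^ (-j) ≤ 9 r`, so the left end point of its
-- interval is within `10 r` of the centre and shares the first `l` digits of `u`.
theorem levelMeasure_ball_cantorPoint_le (h : IsMiddleNinthFamily lam a b) (u : ℕ → Bool) {r : ℝ}
    (hr : 0 < r) {l : ℕ} (hrl : 10 * r ≤ (1 / 3) ^ l) (j : ℕ) :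
    levelMeasure lam a b j (Metric.ball (cantorPoint u) r) ≤
      2⁻¹ ^ l * if l ≤ j then 2 ^ j else 0 := by
  have hfine (hj : 9 * r < (1 / 3) ^ j) :
      levelMeasure lam a b j (Metric.ball (cantorPoint u) r) = 0 :=
    h.levelMeasure_eq_zero measurableSet_ball fun w =>
      disjoint_middleNinth_ball_cantorPoint w u hr.le hj
  split_ifs with hlj
  · rcases lt_or_ge (9 * r) ((1 / 3) ^ j) with hj | hj
    · exact (hfine hj).trans_le zero_le
    · have hcard := h.levelMeasure_le_card (S := Metric.ball (cantorPoint u) r)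
        measurableSet_ball (T := extensions (fun i : Fin l => u i) j) fun w hw =>
          Set.disjoint_left.2 fun y hy hyu => hw <| mem_extensions_of_mem_middleNinth hy <| by
            rw [Metric.mem_ball, Real.dist_eq] at hyu
            linarith
      refine hcard.trans_eq ?_
      rw [card_extensions hlj, Nat.cast_pow, Nat.cast_ofNat, ← ENNReal.inv_pow, mul_comm,
        ← div_eq_mul_inv, ENNReal.eq_div_iff (by positivity) (by finiteness), ← pow_add,
        Nat.add_sub_cancel' hlj]
  · have hpow : (1 / 3 : ℝ) ^ l ≤ (1 / 3) ^ j :=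
      pow_le_pow_of_le_one (by norm_num) (by norm_num) (not_le.1 hlj).le
    exact (hfine (by linarith)).trans_le zero_le

theorem gapMeasure_ball_cantorPoint_le (h : IsMiddleNinthFamily lam a b) (hβ : 1 < β)
    (u : ℕ → Bool) {r : ℝ} (hr : 0 < r) {l : ℕ} (hrl : 10 * r ≤ (1 / 3) ^ l) :
    gapMeasure lam β a b (Metric.ball (cantorPoint u) r) ≤
      ENNReal.ofReal (((1 / 3) ^ l) ^ (β * treeDim (1 / 3))) := by
  have hinv : (2⁻¹ : ℝ≥0∞) ^ l = ENNReal.ofReal (2 ^ (-(l : ℝ))) := by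
    rw [Real.rpow_neg zero_le_two, Real.rpow_natCast, ENNReal.ofReal_inv_of_pos (by positivity),
      ENNReal.ofReal_pow zero_le_two, ENNReal.ofReal_ofNat, ENNReal.inv_pow]
  refine (gapMeasure_le_of_levelMeasure_le hβ measurableSet_ball
    (h.levelMeasure_ball_cantorPoint_le u hr hrl)).trans_eq ?_
  rw [hinv, ← ENNReal.ofReal_mul (by positivity), ← Real.rpow_add two_pos,
    pow_rpow_mul_treeDim (by norm_num) (by norm_num)]
  ring_nf

theorem le_gapMeasure_ball_cantorPoint (h : IsMiddleNinthFamily lam a b) (hβ : 1 < β)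
    (u : ℕ → Bool) {r : ℝ} {k : ℕ} (hkr : (1 / 3) ^ k < r) :
    ENNReal.ofReal ((1 - 2 ^ (1 - β)) * ((1 / 3) ^ k) ^ (β * treeDim (1 / 3))) ≤
      gapMeasure lam β a b (Metric.ball (cantorPoint u) r) :=
  (h.ofReal_le_gapMeasure_middleNinth hβ fun i : Fin k => u i).trans <| measure_mono fun y hy => by
    rw [Metric.mem_ball, dist_comm, Real.dist_eq]
    exact (abs_cantorPoint_sub_le hy).trans_lt hkr

theorem gapMeasure_cthickening_cantorSet_le_of_le_pow (h : IsMiddleNinthFamily lam a b)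
    (hβ : 1 < β) {r : ℝ} (hr : 0 < r) {l : ℕ} (hrl : 9 * r ≤ (1 / 3) ^ l) :
    gapMeasure lam β a b (Metric.cthickening r cantorSet) ≤
      ENNReal.ofReal (((1 / 3) ^ l) ^ ((β - 1) * treeDim (1 / 3))) := by
  have hS : MeasurableSet (Metric.cthickening r cantorSet) :=
    Metric.isClosed_cthickening.measurableSet
  have hlevel (j : ℕ) : levelMeasure lam a b j (Metric.cthickening r cantorSet) ≤
      1 * if l ≤ j then 2 ^ j else 0 := by
    split_ifs with hlj
    · simpa using h.levelMeasure_le_card hS (T := (Finset.univ : Finset (Fin j → Bool)))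
        fun w hw => absurd (Finset.mem_univ w) hw
    · rw [mul_zero, h.levelMeasure_eq_zero hS fun w =>
        disjoint_middleNinth_cthickening_cantorSet w hr.le (hrl.trans_lt ?_)]
      exact pow_lt_pow_right_of_lt_one₀ (by norm_num) (by norm_num) (not_le.1 hlj)
  refine (gapMeasure_le_of_levelMeasure_le hβ hS hlevel).trans_eq ?_
  rw [one_mul, pow_rpow_mul_treeDim (by norm_num) (by norm_num), neg_sub]

theorem gapMeasure_cthickening_cantorSet_le (h : IsMiddleNinthFamily lam a b) (hβ : 1 < β) {r : ℝ}
    (hr : 0 < r) : gapMeasure lam β a b (Metric.cthickening r cantorSet) ≤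
      ENNReal.ofReal (27 ^ ((β - 1) * treeDim (1 / 3)) * r ^ ((β - 1) * treeDim (1 / 3))) := by
  have := h.isProbabilityMeasure_gapMeasure hβ
  have hexp : 0 ≤ (β - 1) * treeDim (1 / 3) :=
    mul_nonneg (sub_pos.2 hβ).le (treeDim_pos (by norm_num) (by norm_num)).le
  rw [← Real.mul_rpow (by norm_num) hr.le]
  rcases le_or_gt (9 * r) 1 with hr1 | hr1
  · obtain ⟨l, hrl, hlr⟩ := exists_le_third_pow_le (x := 9 * r) (by positivity) hr1
    refine (h.gapMeasure_cthickening_cantorSet_le_of_le_pow hβ hr hrl).trans ?_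
    gcongr
    linarith
  · exact prob_le_one.trans (ENNReal.one_le_ofReal.2 (Real.one_le_rpow (by linarith) hexp))

theorem localDim_of_mem_cantorSet (h : IsMiddleNinthFamily lam a b) (hβ : 1 < β) {x : ℝ}
    (hx : x ∈ cantorSet) :
    lowerLocalDim (gapMeasure lam β a b) x = (β * treeDim (1 / 3) : ℝ) ∧
      upperLocalDim (gapMeasure lam β a b) x = (β * treeDim (1 / 3) : ℝ) := by
  have := h.isProbabilityMeasure_gapMeasure hβ
  have hD : 0 ≤ β * treeDim (1 / 3) :=
    mul_nonneg (by linarith) (treeDim_pos (by norm_num) (by norm_num)).le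
  have hq : 0 < 1 - (2 : ℝ) ^ (1 - β) := sub_pos.2 (two_rpow_one_sub_lt_one hβ)
  rw [← range_cantorPoint] at hx
  obtain ⟨u, rfl⟩ := hx
  refine lowerLocalDim_eq_and_upperLocalDim_eq (C := 30 ^ (β * treeDim (1 / 3)))
    (c := (1 - 2 ^ (1 - β)) * (1 / 6) ^ (β * treeDim (1 / 3))) hD (by positivity)
    (fun r hr hr1 => ?_) ?_
  · obtain ⟨k, hrk, hkr⟩ := exists_le_third_pow_le (x := r / 6) (by positivity) (by linarith)
    refine le_trans ?_ (h.le_gapMeasure_ball_cantorPoint hβ u (k := k) (by linarith))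
    rw [mul_assoc, ← Real.mul_rpow (by norm_num) hr.le]
    gcongr
    linarith
  · filter_upwards [Ioc_mem_nhdsGT (show (0 : ℝ) < 1 / 10 by norm_num)] with r ⟨hr, hr1⟩
    obtain ⟨l, hrl, hlr⟩ := exists_le_third_pow_le (x := 10 * r) (by positivity) (by linarith)
    refine (h.gapMeasure_ball_cantorPoint_le hβ u hr hrl).trans ?_
    rw [← Real.mul_rpow (by norm_num) hr.le]
    gcongr
    linarith

theorem exists_eventually_gapMeasure_ball_le (h : IsMiddleNinthFamily lam a b) (hβ : 1 < β) {x : ℝ}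
    (hx : x ∉ cantorSet) : ∃ J : ℕ, ∀ᶠ r in 𝓝[>] (0 : ℝ),
      gapMeasure lam β a b (Metric.ball x r) ≤
        ∑ j ∈ Finset.range J, levelMeasure lam a b j (Metric.ball x r) := by
  obtain ⟨δ, hδ, hδx⟩ := Metric.isOpen_iff.1 isClosed_cantorSet.isOpen_compl x hx
  obtain ⟨J, hJ⟩ := exists_pow_lt_of_lt_one (half_pos hδ) (by norm_num : (1 / 3 : ℝ) < 1)
  refine ⟨J, ?_⟩
  filter_upwards [Ioc_mem_nhdsGT (half_pos hδ)] with r ⟨_, hr⟩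
  refine gapMeasure_le_sum_levelMeasure hβ measurableSet_ball fun j hj =>
    h.levelMeasure_eq_zero measurableSet_ball fun w => Set.disjoint_left.2 fun y hy hyr => ?_
  have hpow : (1 / 3 : ℝ) ^ j ≤ (1 / 3) ^ J := pow_le_pow_of_le_one (by norm_num) (by norm_num) hj
  refine hδx (Metric.mem_ball.2 ?_) (cantorLeft_mem w)
  have hdist := abs_cantorLeft_sub_le hy
  rw [← Real.dist_eq] at hdist
  linarith [dist_triangle (cantorLeft w) y x, Metric.mem_ball.1 hyr]

theorem exists_levelMeasure_ball_le (h : IsMiddleNinthFamily lam a b) (j : ℕ) :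
    ∃ C : ℝ≥0, ∀ x r, 0 < r →
      levelMeasure lam a b j (Metric.ball x r) ≤ C * ENNReal.ofReal (r ^ treeDim lam) := by
  choose C hC using fun w => (h.isBinaryCoding j w).coinMeasure_map_ball_le
  refine ⟨∑ w, C w, fun x r hr => ?_⟩
  rw [h.levelMeasure_apply, ENNReal.ofNNReal_finsetSum, Finset.sum_mul]
  exact Finset.sum_le_sum fun w _ => hC w x r hr

theorem localDim_of_mem_support_levelMeasure (h : IsMiddleNinthFamily lam a b) (hβ : 1 < β) {k : ℕ}
    {x : ℝ} (hx : x ∈ (levelMeasure lam a b k).support) :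
    lowerLocalDim (gapMeasure lam β a b) x = treeDim lam ∧
      upperLocalDim (gapMeasure lam β a b) x = treeDim lam := by
  have := h.isProbabilityMeasure_gapMeasure hβ
  have hq : 0 < 1 - (2 : ℝ) ^ (1 - β) := sub_pos.2 (two_rpow_one_sub_lt_one hβ)
  have hlam1 : lam < 1 := h.lam_lt.trans one_half_lt_one
  rw [h.support_levelMeasure] at hx
  obtain ⟨w, u, rfl⟩ := mem_iUnion.1 hx
  obtain ⟨c, hc, hlow⟩ := (h.isBinaryCoding k w).le_coinMeasure_map_ball
  obtain ⟨J, hJ⟩ := h.exists_eventually_gapMeasure_ball_le hβ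
    (notMem_cantorSet_of_mem_middleNinth (h.mem_middleNinth k w u))
  choose C hC using h.exists_levelMeasure_ball_le
  refine lowerLocalDim_eq_and_upperLocalDim_eq (c := (1 - 2 ^ (1 - β)) * 2 ^ (-β * k) * c)
    (C := ((∑ j ∈ Finset.range J, C j : ℝ≥0) : ℝ)) (treeDim_pos h.lam_pos hlam1).le
    (by positivity) (fun r hr hr1 => ?_) ?_
  · rw [mul_assoc, ENNReal.ofReal_mul (by positivity)]
    exact (mul_le_mul_right (hlow u r hr hr1) _).trans (h.smul_map_le_gapMeasure hβ k w _)
  · filter_upwards [hJ, self_mem_nhdsWithin] with r hrJ hr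
    refine hrJ.trans ?_
    rw [ENNReal.ofReal_mul NNReal.zero_le_coe, ENNReal.ofReal_coe_nnreal,
      ENNReal.ofNNReal_finsetSum, Finset.sum_mul]
    exact Finset.sum_le_sum fun j _ => hC j _ r hr

theorem support_gapMeasure_subset (h : IsMiddleNinthFamily lam a b) (hβ : 1 < β) :
    (gapMeasure lam β a b).support ⊆ cantorSet ∪ ⋃ k : ℕ, (levelMeasure lam a b k).support := by
  intro x hx
  by_contra hne
  rw [mem_union, mem_iUnion, not_or, not_exists] at hne
  obtain ⟨J, hJ⟩ := h.exists_eventually_gapMeasure_ball_le hβ hne.1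
  have hzero : ∀ᶠ r in 𝓝[>] (0 : ℝ), ∀ j ∈ Finset.range J,
      levelMeasure lam a b j (Metric.ball x r) = 0 :=
    (Finset.eventually_all _).2 fun j _ => eventually_measure_ball_eq_zero (hne.2 j)
  obtain ⟨r, hr, hrJ, hrzero⟩ := (eventually_mem_nhdsWithin.and (hJ.and hzero)).exists
  refine (Metric.nhds_basis_ball.mem_measureSupport.1 hx r hr).ne' ?_
  exact le_zero_iff.1 (hrJ.trans_eq (Finset.sum_eq_zero hrzero))

theorem support_gapMeasure (h : IsMiddleNinthFamily lam a b) (hβ : 1 < β) :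
    (gapMeasure lam β a b).support = cantorSet ∪ ⋃ k : ℕ, (levelMeasure lam a b k).support := by
  have := h.isProbabilityMeasure_gapMeasure hβ
  refine (h.support_gapMeasure_subset hβ).antisymm fun x hx => ?_
  suffices lowerLocalDim (gapMeasure lam β a b) x ≠ ⊤ from
    not_imp_comm.1 (fun hne => (lowerLocalDim_eq_top_and_upperLocalDim_eq_top hne).1) this
  rcases hx with hx | hx
  · exact (h.localDim_of_mem_cantorSet hβ hx).1 ▸ EReal.coe_ne_top _
  · obtain ⟨k, hk⟩ := mem_iUnion.1 hx
    exact (h.localDim_of_mem_support_levelMeasure hβ hk).1 ▸ EReal.coe_ne_top _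

end IsMiddleNinthFamily

/-! ### Spectra and random limsup sets of the gap measure -/

theorem hausdorffSpectrum_eq_dimH {X : Type*} [MetricSpace X] [MeasurableSpace X]
    (μ : Measure X) [IsFiniteMeasure μ] (s : ℝ) :
    hausdorffSpectrum μ s = dimH {x | lowerLocalDim μ x ≤ s} := by
  refine congrArg dimH (Set.ext fun x => and_iff_right_of_imp fun hx => ?_)
  by_contra hne
  rw [(lowerLocalDim_eq_top_and_upperLocalDim_eq_top hne).1, top_le_iff] at hx
  exact EReal.coe_ne_top s hx

theorem coveringDim_eq_of_ae_eq {X : Type*} [MetricSpace X] [MeasurableSpace X] {μ : Measure X}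
    [IsProbabilityMeasure μ] {α : ℝ} {d : ℝ≥0∞}
    (h : ∀ᵐ ω ∂(Measure.infinitePi fun _ : ℕ => μ), dimH (limsupBalls α ω) = d) :
    coveringDim μ α = d := by
  rw [coveringDim, essSup_congr_ae h, essSup_const _ (IsProbabilityMeasure.ne_zero _)]

theorem ae_limsupBalls_subset_support {X : Type*} [MetricSpace X] [SecondCountableTopology X]
    [MeasurableSpace X] [BorelSpace X] {μ : Measure X} [IsProbabilityMeasure μ] {α : ℝ}
    (hα : 0 < α) :
    ∀ᵐ ω ∂(Measure.infinitePi fun _ : ℕ => μ), limsupBalls α ω ⊆ μ.support := by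
  have hω : ∀ᵐ ω ∂(Measure.infinitePi fun _ : ℕ => μ), ∀ n, ω n ∈ μ.support :=
    ae_all_iff.2 fun n => (measurePreserving_eval_infinitePi
      (fun _ : ℕ => μ) n).quasiMeasurePreserving.ae Measure.support_mem_ae
  exact hω.mono fun _ => limsupBalls_subset_of_isClosed hα Measure.isClosed_support

theorem treeDim_third : treeDim (1 / 3) = Real.log 2 / Real.log 3 := by
  rw [treeDim, one_div, Real.log_inv, neg_neg]

theorem treeDim_third_pos : 0 < treeDim (1 / 3) :=
  treeDim_pos (by norm_num) (by norm_num)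

theorem upperBoxDim_cantorSet_le : upperBoxDim cantorSet ≤ treeDim (1 / 3) :=
  range_cantorPoint ▸ isBinaryCoding_cantorPoint.upperBoxDim_range_le

theorem le_dimH_cantorSet : ENNReal.ofReal (treeDim (1 / 3)) ≤ dimH cantorSet :=
  range_cantorPoint ▸ isBinaryCoding_cantorPoint.ofReal_treeDim_le_dimH_range

namespace IsMiddleNinthFamily

variable {lam β : ℝ} {a b : (k : ℕ) → (Fin k → Bool) → ℝ}

theorem notMem_cantorSet_of_mem_support_levelMeasure (h : IsMiddleNinthFamily lam a b) {k : ℕ}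
    {x : ℝ} (hx : x ∈ (levelMeasure lam a b k).support) : x ∉ cantorSet := by
  rw [h.support_levelMeasure] at hx
  obtain ⟨w, u, rfl⟩ := mem_iUnion.1 hx
  exact notMem_cantorSet_of_mem_middleNinth (h.mem_middleNinth k w u)

theorem lowerLocalDim_eq_upperLocalDim (h : IsMiddleNinthFamily lam a b) (hβ : 1 < β) (x : ℝ) :
    lowerLocalDim (gapMeasure lam β a b) x = upperLocalDim (gapMeasure lam β a b) x := by
  have := h.isProbabilityMeasure_gapMeasure hβ
  suffices ∃ d, lowerLocalDim (gapMeasure lam β a b) x = d ∧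
      upperLocalDim (gapMeasure lam β a b) x = d from this.elim fun _ hd => hd.1.trans hd.2.symm
  by_cases hx : x ∈ (gapMeasure lam β a b).support
  · rw [h.support_gapMeasure hβ] at hx
    rcases hx with hx | hx
    · exact ⟨_, h.localDim_of_mem_cantorSet hβ hx⟩
    · exact ⟨_, h.localDim_of_mem_support_levelMeasure hβ (mem_iUnion.1 hx).choose_spec⟩
  · exact ⟨_, lowerLocalDim_eq_top_and_upperLocalDim_eq_top hx⟩

theorem setOf_lowerLocalDim_le (h : IsMiddleNinthFamily lam a b) (hβ : 1 < β) (s : ℝ) :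
    {x | lowerLocalDim (gapMeasure lam β a b) x ≤ s} =
      {x ∈ cantorSet | β * treeDim (1 / 3) ≤ s} ∪
        {x ∈ ⋃ k : ℕ, (levelMeasure lam a b k).support | treeDim lam ≤ s} := by
  have := h.isProbabilityMeasure_gapMeasure hβ
  ext x
  simp only [mem_union, mem_ofPred_eq]
  by_cases hC : x ∈ cantorSet
  · have hL : x ∉ ⋃ k : ℕ, (levelMeasure lam a b k).support := fun hx =>
      h.notMem_cantorSet_of_mem_support_levelMeasure (mem_iUnion.1 hx).choose_spec hC
    simp only [(h.localDim_of_mem_cantorSet hβ hC).1, EReal.coe_le_coe_iff, hC, hL, true_and,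
      false_and, or_false]
  by_cases hL : x ∈ ⋃ k : ℕ, (levelMeasure lam a b k).support
  · simp only [(h.localDim_of_mem_support_levelMeasure hβ (mem_iUnion.1 hL).choose_spec).1,
      EReal.coe_le_coe_iff, hC, hL, true_and, false_and, false_or]
  · have hx : x ∉ (gapMeasure lam β a b).support := by
      rw [h.support_gapMeasure hβ]
      exact fun hx => hx.elim hC hL
    simp only [(lowerLocalDim_eq_top_and_upperLocalDim_eq_top hx).1, top_le_iff, EReal.coe_ne_top,
      hC, hL, false_and, or_false]

theorem iUnion_support_levelMeasure (h : IsMiddleNinthFamily lam a b) :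
    ⋃ k : ℕ, (levelMeasure lam a b k).support =
      ⋃ p : Σ k : ℕ, Fin k → Bool, range (gapMap lam a b p.1 p.2) := by
  simp only [h.support_levelMeasure, iUnion_sigma]

theorem dim_iUnion_support_levelMeasure (h : IsMiddleNinthFamily lam a b) :
    dimH (⋃ k : ℕ, (levelMeasure lam a b k).support) = ENNReal.ofReal (treeDim lam) ∧
      packingDim (⋃ k : ℕ, (levelMeasure lam a b k).support) = ENNReal.ofReal (treeDim lam) := by
  have : Nonempty (Σ k : ℕ, Fin k → Bool) := ⟨⟨0, ![]⟩⟩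
  rw [h.iUnion_support_levelMeasure]
  refine dimH_iUnion_eq_and_packingDim_iUnion_eq
    (fun p => (h.isBinaryCoding p.1 p.2).upperBoxDim_range_le) ?_
  exact (h.isBinaryCoding 0 ![]).ofReal_treeDim_le_dimH_range.trans <| dimH_mono <|
    subset_iUnion (fun p : Σ k : ℕ, Fin k → Bool => range (gapMap lam a b p.1 p.2)) ⟨0, ![]⟩

theorem dim_cantorSet_union_iUnion_support_levelMeasure (h : IsMiddleNinthFamily lam a b)
    (hlam : lam ≤ 1 / 3) :
    dimH (cantorSet ∪ ⋃ k : ℕ, (levelMeasure lam a b k).support) =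
        ENNReal.ofReal (treeDim (1 / 3)) ∧
      packingDim (cantorSet ∪ ⋃ k : ℕ, (levelMeasure lam a b k).support) =
        ENNReal.ofReal (treeDim (1 / 3)) := by
  have hunion : cantorSet ∪ ⋃ k : ℕ, (levelMeasure lam a b k).support =
      ⋃ p : Option (Σ k : ℕ, Fin k → Bool),
        p.elim cantorSet fun p => range (gapMap lam a b p.1 p.2) := by
    rw [iUnion_option, h.iUnion_support_levelMeasure]
    rfl
  rw [hunion]
  refine dimH_iUnion_eq_and_packingDim_iUnion_eq (fun p => ?_) ?_
  · cases p with
    | none => exact upperBoxDim_cantorSet_le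
    | some p =>
      exact (h.isBinaryCoding p.1 p.2).upperBoxDim_range_le.trans
        (EReal.coe_le_coe_iff.2 (treeDim_le_treeDim h.lam_pos hlam (by norm_num)))
  · rw [← hunion]
    exact le_dimH_cantorSet.trans (dimH_mono subset_union_left)

theorem hausdorffSpectrum_eq_and_packingSpectrum_eq (h : IsMiddleNinthFamily lam a b) (hβ : 1 < β)
    (hlam : lam ≤ 1 / 3) (s : ℝ) :
    hausdorffSpectrum (gapMeasure lam β a b) s =
        (if s < treeDim lam then 0 else if s < β * treeDim (1 / 3) then
          ENNReal.ofReal (treeDim lam) else ENNReal.ofReal (treeDim (1 / 3))) ∧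
      packingSpectrum (gapMeasure lam β a b) s =
        (if s < treeDim lam then 0 else if s < β * treeDim (1 / 3) then
          ENNReal.ofReal (treeDim lam) else ENNReal.ofReal (treeDim (1 / 3))) := by
  have := h.isProbabilityMeasure_gapMeasure hβ
  have hs : treeDim lam < β * treeDim (1 / 3) :=
    (treeDim_le_treeDim h.lam_pos hlam (by norm_num)).trans_lt (lt_mul_left treeDim_third_pos hβ)
  rw [hausdorffSpectrum_eq_dimH, packingSpectrum, h.setOf_lowerLocalDim_le hβ]
  split_ifs with hs₀ hs₁
  · simp only [hs₀.not_ge, (hs₀.trans hs).not_ge, sep_false, union_self, dimH_empty,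
      packingDim_empty, and_self]
  · simp only [not_lt.1 hs₀, hs₁.not_ge, sep_false, sep_true, empty_union]
    exact h.dim_iUnion_support_levelMeasure
  · simp only [not_lt.1 hs₀, not_lt.1 hs₁, sep_true]
    exact h.dim_cantorSet_union_iUnion_support_levelMeasure hlam

theorem hausdorffSpectrumHull_eq (h : IsMiddleNinthFamily lam a b) (hβ : 1 < β)
    (hlam : lam ≤ 1 / 3) {s : ℝ} (hs : 0 ≤ s) :
    hausdorffSpectrumHull (gapMeasure lam β a b) s =
      max (min s (treeDim lam))
        (min s (β * treeDim (1 / 3)) - (β * treeDim (1 / 3) - treeDim (1 / 3))) := by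
  have h0 : 0 < treeDim lam := treeDim_pos h.lam_pos (h.lam_lt.trans one_half_lt_one)
  have h1 : treeDim lam ≤ treeDim (1 / 3) := treeDim_le_treeDim h.lam_pos hlam (by norm_num)
  rw [← increasingLipschitzHull_step h0.le h1 (h1.trans_lt (lt_mul_left treeDim_third_pos hβ)) hs,
    hausdorffSpectrumHull]
  congr! 2 with z
  rw [(h.hausdorffSpectrum_eq_and_packingSpectrum_eq hβ hlam z).1]
  split_ifs
  exacts [ENNReal.toReal_zero, ENNReal.toReal_ofReal h0.le,
    ENNReal.toReal_ofReal treeDim_third_pos.le]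

theorem ae_dimH_limsupBalls_gapMeasure_le (h : IsMiddleNinthFamily lam a b) (hβ : 1 < β) {α : ℝ}
    (hα : 0 < α) :
    ∀ᵐ ω ∂(Measure.infinitePi fun _ : ℕ => gapMeasure lam β a b), dimH (limsupBalls α ω) ≤
      ENNReal.ofReal (max (min (treeDim lam) (1 / α))
        (min (treeDim (1 / 3)) (1 / α - (β - 1) * treeDim (1 / 3)))) := by
  have := h.isProbabilityMeasure_gapMeasure hβ
  have hall := ae_dimH_limsupBalls_inter_le (μ := gapMeasure lam β a b) (C := univ) (K := 1)
    (γ := 0) hα fun r _ _ => by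
      simpa only [Real.rpow_zero, mul_one, ENNReal.ofReal_one] using prob_le_one
  have hcantor := ae_dimH_limsupBalls_inter_le (μ := gapMeasure lam β a b) hα fun r hr _ =>
    h.gapMeasure_cthickening_cantorSet_le hβ hr
  have hdimC : dimH cantorSet ≤ ENNReal.ofReal (treeDim (1 / 3)) :=
    dimH_le_of_upperBoxDim_le <| upperBoxDim_cantorSet_le.trans <| by
      rw [EReal.coe_ennreal_ofReal]
      exact EReal.coe_le_coe_iff.2 (le_max_left _ _)
  filter_upwards [hall, hcantor, ae_limsupBalls_subset_support hα] with ω hall hcantor hsub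
  rw [inter_univ, sub_zero] at hall
  rw [h.support_gapMeasure hβ, union_comm] at hsub
  rw [← inter_eq_left.2 hsub, inter_union_distrib_left, dimH_union, ENNReal.ofReal_max,
    ENNReal.ofReal_min, ENNReal.ofReal_min]
  gcongr
  · exact le_min ((dimH_mono inter_subset_right).trans h.dim_iUnion_support_levelMeasure.1.le)
      ((dimH_mono inter_subset_left).trans hall)
  · exact le_min ((dimH_mono inter_subset_right).trans hdimC) hcantor

theorem ae_le_dimH_limsupBalls_gapMeasure (h : IsMiddleNinthFamily lam a b) (hβ : 1 < β) {α : ℝ}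
    (hα : 0 < α) :
    ∀ᵐ ω ∂(Measure.infinitePi fun _ : ℕ => gapMeasure lam β a b),
      ENNReal.ofReal (max (min (treeDim lam) (1 / α))
        (min (treeDim (1 / 3)) (1 / α - (β - 1) * treeDim (1 / 3)))) ≤
          dimH (limsupBalls α ω) := by
  have := h.isProbabilityMeasure_gapMeasure hβ
  have hq : 0 < 1 - (2 : ℝ) ^ (1 - β) := sub_pos.2 (two_rpow_one_sub_lt_one hβ)
  have hlevel := ae_le_dimH_limsupBalls_of_smul_map_le (h.isBinaryCoding 0 ![]) hα
    (by positivity) (h.smul_map_le_gapMeasure hβ 0 ![])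
  have hcantor := ae_le_dimH_limsupBalls (μ := gapMeasure lam β a b) (A := 1)
    (D := β * treeDim (1 / 3)) (U := fun m u => middleNinth u) isBinaryCoding_cantorPoint hα hq
    one_pos (fun m u => measurableSet_middleNinth u) pairwise_disjoint_middleNinth
    (fun m u => h.ofReal_le_gapMeasure_middleNinth hβ u)
    fun m u y hy => by rw [one_mul]; exact abs_cantorPoint_sub_le hy
  filter_upwards [hlevel, hcantor] with ω hlevel hcantor
  rw [ENNReal.ofReal_max, sub_one_mul]
  exact max_le hlevel hcantor

theorem ae_dimH_limsupBalls_gapMeasure (h : IsMiddleNinthFamily lam a b) (hβ : 1 < β)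
    (hlam : lam ≤ 1 / 3) {α : ℝ} (hα : 0 < α) :
    ∀ᵐ ω ∂(Measure.infinitePi fun _ : ℕ => gapMeasure lam β a b), dimH (limsupBalls α ω) =
      ENNReal.ofReal (hausdorffSpectrumHull (gapMeasure lam β a b) (1 / α)) := by
  rw [h.hausdorffSpectrumHull_eq hβ hlam (by positivity), ← min_sub_sub_right, sub_sub_cancel,
    ← sub_one_mul, min_comm (1 / α), min_comm (1 / α - _)]
  filter_upwards [h.ae_dimH_limsupBalls_gapMeasure_le hβ hα,
    h.ae_le_dimH_limsupBalls_gapMeasure hβ hα] with ω hle hge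
  exact hle.antisymm hge

end IsMiddleNinthFamily

theorem mainTheorem5 (lam β : ℝ) (hlam0 : 0 < lam) (hlam1 : lam < 1 / 3) (hβ : 1 < β)
    (a b : (k : ℕ) → (Fin k → Bool) → ℝ)
    (ha : ∀ (k : ℕ) (w : Fin k → Bool), a k w ≠ 0)
    (hab : ∀ (k : ℕ) (w : Fin k → Bool), ∀ x ∈ (bernoulliConvolution lam).support,
      a k w * x + b k w ∈ middleNinth w)
    (μ : Measure ℝ) (hμ : μ = gapMeasure lam β a b)
    (s₀ s₁ d₁ : ℝ) (hs₀ : s₀ = Real.log 2 / (-Real.log lam))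
    (hs₁ : s₁ = β * Real.log 2 / Real.log 3) (hd₁ : d₁ = Real.log 2 / Real.log 3) :
    IsProbabilityMeasure μ ∧
    -- the support
    μ.support = cantorSet ∪ ⋃ k : ℕ, (levelMeasure lam a b k).support ∧
    -- the local dimensions
    (∀ x : ℝ, lowerLocalDim μ x = upperLocalDim μ x) ∧
    (∀ k : ℕ, ∀ x ∈ (levelMeasure lam a b k).support, lowerLocalDim μ x = (s₀ : EReal)) ∧
    (∀ x ∈ cantorSet, lowerLocalDim μ x = (s₁ : EReal)) ∧
    (∀ x : ℝ, x ∉ μ.support → lowerLocalDim μ x = ⊤) ∧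
    -- the Hausdorff and packing spectra
    (∀ s : ℝ, hausdorffSpectrum μ s =
      if s < s₀ then 0 else if s < s₁ then ENNReal.ofReal s₀ else ENNReal.ofReal d₁) ∧
    (∀ s : ℝ, packingSpectrum μ s = hausdorffSpectrum μ s) ∧
    -- the increasing 1-Lipschitz hull of the Hausdorff spectrum, which is not concave
    (∀ s : ℝ, 0 ≤ s →
      hausdorffSpectrumHull μ s = max (min s s₀) (min s s₁ - (s₁ - d₁))) ∧
    ¬ ConcaveOn ℝ (Ioi (0 : ℝ)) (hausdorffSpectrumHull μ) ∧
    -- the almost sure dimension of the random limsup sets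
    (∀ α : ℝ, 0 < α →
      (∀ᵐ ω ∂(Measure.infinitePi fun _ : ℕ => μ),
        dimH (limsupBalls α ω) = coveringDim μ α) ∧
      coveringDim μ α = ENNReal.ofReal (hausdorffSpectrumHull μ (1 / α)) ∧
      (1 / α ≤ s₁ →
        ENNReal.ofReal (1 / α - (β - 1) * (Real.log 2 / Real.log 3)) ≤ coveringDim μ α)) := by
  subst hμ
  change s₀ = treeDim lam at hs₀
  rw [mul_div_assoc, ← treeDim_third] at hs₁
  rw [← treeDim_third] at hd₁ ⊢
  subst hs₀ hs₁ hd₁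
  have h : IsMiddleNinthFamily lam a b := ⟨hlam0, by linarith, ha, fun k w u => hab k w _ (by
    rw [support_bernoulliConvolution hlam0 (by linarith)]
    exact mem_range_self u)⟩
  have hprob := h.isProbabilityMeasure_gapMeasure hβ
  have hspectrum := h.hausdorffSpectrum_eq_and_packingSpectrum_eq hβ hlam1.le
  have hhull := fun s => h.hausdorffSpectrumHull_eq hβ hlam1.le (s := s)
  refine ⟨hprob, h.support_gapMeasure hβ, h.lowerLocalDim_eq_upperLocalDim hβ,
    fun k x hx => (h.localDim_of_mem_support_levelMeasure hβ hx).1,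
    fun x hx => (h.localDim_of_mem_cantorSet hβ hx).1,
    fun x hx => (lowerLocalDim_eq_top_and_upperLocalDim_eq_top hx).1,
    fun s => (hspectrum s).1, fun s => (hspectrum s).2.trans (hspectrum s).1.symm, hhull,
    not_concaveOn_of_eq_max_min (treeDim_pos hlam0 (by linarith))
      (treeDim_lt_treeDim hlam0 hlam1 (by norm_num)) (lt_mul_left treeDim_third_pos hβ) hhull,
    fun α hα => ?_⟩
  have hae := h.ae_dimH_limsupBalls_gapMeasure hβ hlam1.le hα
  have hcov := coveringDim_eq_of_ae_eq hae
  refine ⟨hcov ▸ hae, hcov, fun hle => hcov ▸ ENNReal.ofReal_le_ofReal ?_⟩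
  rw [hhull _ (by positivity), min_eq_left hle, sub_one_mul]
  exact le_max_right _ _
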